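/- All graphs are finite and simple. A *star* is a graph isomorphic to $K_{1,n}$ for some $n\ge 1$; a *star-factor* of a graph $G$ is a spanning subgraph of $G$ each of whose components is a star; and $G$ is *star-uniform* if all star-factors of $G$ have the same number of components. A set $D$ of vertices of $G$ is *dominating* if every vertex of $G$ is in $D$ or adjacent to a vertex of $D$; the *domination number* $\gamma(G)$ is the smallest size of a dominating set. Write $C_n$ for the cycle with vertices $0,1,\dots,n-1$ in cyclic order, and $C_n+\{\dots\}$ for the graph obtained from it by adding the listed chords. **Theorem.** Let $G$ be a connected graph with minimum degree $\delta(G)\ge 2$. Then $G$ is star-uniform if and only if one of the following holds: 1. $G$ is isomorphic to one of the nine graphs $C_3$, $C_5$, $C_5+\{13\}$, $C_5+\{13,24\}$, $C_7$, $C_7+\{15\}$, $C_7+\{14,25\}$, $C_7+\{14,15\}$, $C_7+\{14,15,25\}$; 2. $G$ is bipartite, with a bipartition $X\cup Y$ of its vertex set such that $\gamma(G)=|X|\le|Y|$, and $G$ has girth $4$. -/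

import Mathlib

namespace SimpleGraph

/-- A star is a graph isomorphic to `K_{1,n}` for some `n ≥ 1`. -/
def IsStar {W : Type*} (T : SimpleGraph W) : Prop :=
  ∃ n : ℕ, 1 ≤ n ∧ Nonempty (T ≃g completeBipartiteGraph (Fin 1) (Fin n))

/-- `S` is a star-factor of `G`: a spanning subgraph of `G` each of whose components is a star.
(A spanning subgraph is a graph on the same vertex set whose edges are edges of `G`.) -/
def IsStarFactor {V : Type*} (G S : SimpleGraph V) : Prop :=
  S ≤ G ∧ ∀ C : S.ConnectedComponent, C.toSimpleGraph.IsStar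

/-- `G` is star-uniform: all star-factors of `G` have the same number of components. -/
def IsStarUniform {V : Type*} (G : SimpleGraph V) : Prop :=
  ∀ S T : SimpleGraph V, G.IsStarFactor S → G.IsStarFactor T →
    Nat.card S.ConnectedComponent = Nat.card T.ConnectedComponent

/-- `D` is a dominating set of `G`: every vertex is in `D` or adjacent to a vertex of `D`. -/
def IsDominatingSet {V : Type*} (G : SimpleGraph V) (D : Finset V) : Prop :=
  ∀ v : V, v ∈ D ∨ ∃ u ∈ D, G.Adj v u

/-- The domination number of a finite graph: the least size of a dominating set
(the whole vertex set is always dominating). -/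
noncomputable def dominationNumber {V : Type*} [Fintype V] (G : SimpleGraph V) : ℕ :=
  sInf {n : ℕ | ∃ D : Finset V, G.IsDominatingSet D ∧ D.card = n}

/-- The nine exceptional graphs: the triangle; the 5-cycle, alone, with one chord, or with two
crossing chords; the 7-cycle, alone or with one of four particular sets of chords. The vertices
of `cycleGraph n` are `0, …, n - 1` in cyclic order. -/
def IsExceptional {V : Type*} (G : SimpleGraph V) : Prop :=
  Nonempty (G ≃g cycleGraph 3) ∨
  Nonempty (G ≃g cycleGraph 5) ∨
  Nonempty (G ≃g cycleGraph 5 ⊔ fromEdgeSet {s(1, 3)}) ∨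
  Nonempty (G ≃g cycleGraph 5 ⊔ fromEdgeSet {s(1, 3), s(2, 4)}) ∨
  Nonempty (G ≃g cycleGraph 7) ∨
  Nonempty (G ≃g cycleGraph 7 ⊔ fromEdgeSet {s(1, 5)}) ∨
  Nonempty (G ≃g cycleGraph 7 ⊔ fromEdgeSet {s(1, 4), s(2, 5)}) ∨
  Nonempty (G ≃g cycleGraph 7 ⊔ fromEdgeSet {s(1, 4), s(1, 5)}) ∨
  Nonempty (G ≃g cycleGraph 7 ⊔ fromEdgeSet {s(1, 4), s(1, 5), s(2, 5)})

end SimpleGraph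

/-!
For a graph without isolated vertices the number of components of a star-factor takes its least
value at the domination number `γ` and its greatest value at the matching number `ν`, so
star-uniformity amounts to `γ = ν`. Matchings are encoded as involutions `σ` of the vertex set whose
fixed points are the unsaturated vertices. `IsStarUniform.isTight` derives `ν ≤ γ` from
star-uniformity, and `IsTight.card_le` localises it: a union `W` of `k` matching edges and some
unsaturated vertices cannot be dominated by fewer than `k` vertices, provided that the remaining
unsaturated vertices can still be dominated. Each structural step below exhibits a set `W`
violating this.

*Two vertices missed by maximum matchings are adjacent.* Following the two matchings alternately
yields a flower, that is, an odd cycle `q 0, …, q (2 * j)` on which a maximum matching misses only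
`q 0` (`IsMaxMatchingMap.exists_isFlower`). Any vertex of the cycle can be made the base, and the
dominating sets of the cycle show that a longest flower spans the graph (`IsFlower.spanning`).
Every third vertex of a spanning cycle dominates, so `j ≤ 3` (`IsFlower.le_three`). On five vertices
no vertex is dominating, and on seven no pair is; this restricts the chords to the listed sets up to
rotation.

*No two such vertices are adjacent.* If some vertex is missed, the alternating closure `R` of the
unsaturated vertices is independent, its neighbourhood `A` is matched into `R`, and tightness shows
that `A ∪ R` is everything and `A` is independent (`IsTight.bipartite_of_unsat_nonempty`). If the
matching is perfect, the graph is a 4-cycle (`IsTight.bipartite_of_perfect`). In both cases there is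
a 4-cycle: replacing two neighbours `x`, `x'` of a vertex `y` by `y` makes the dominating part
smaller, so some other vertex is adjacent to exactly `x` and `x'`
(`IsBipartiteWith.girth_eq_four`).

Conversely, the number of components of a star-factor is at least `γ`, at most half the order and at
most the size of any vertex cover, and these bounds coincide for the listed graphs.
-/

namespace SimpleGraph

/-! ### Star factors, centres and dominating sets -/

theorem isStar_of_center {W : Type*} [Finite W] (T : SimpleGraph W) (z w : W) (hw : w ≠ z)
    (h : ∀ x y, T.Adj x y ↔ x ≠ y ∧ (x = z ∨ y = z)) : T.IsStar := by
  classical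
  have := Fintype.ofFinite W
  refine ⟨Fintype.card {x // ¬ x = z}, Fintype.card_pos_iff.2 ⟨⟨w, hw⟩⟩, ⟨?_⟩⟩
  let e : W ≃ Fin 1 ⊕ Fin (Fintype.card {x // ¬ x = z}) :=
    (Equiv.sumCompl (fun x => x = z)).symm.trans
      (Equiv.sumCongr (Equiv.ofUnique _ _) (Fintype.equivFin _))
  have hl : ∀ i, e.symm (Sum.inl i) = z := fun i => ((Equiv.ofUnique {x // x = z} _).symm i).2
  have hr : ∀ i, e.symm (Sum.inr i) ≠ z := fun i => ((Fintype.equivFin {x // ¬ x = z}).symm i).2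
  refine (⟨e.symm, ?_⟩ : completeBipartiteGraph (Fin 1) (Fin _) ≃g T).symm
  rintro (i | i) (j | j)
  · simp [hl]
  · simp [h, hl, Ne.symm (hr j)]
  · simp [h, hl, hr i]
  · simp [h, hr]

theorem IsStar.exists_center {W : Type*} {T : SimpleGraph W} (h : T.IsStar) :
    ∃ z w : W, T.Adj z w ∧ ∀ x, x ≠ z → T.Adj x z := by
  obtain ⟨n, hn, ⟨e⟩⟩ := h
  refine ⟨e.symm (Sum.inl 0), e.symm (Sum.inr ⟨0, hn⟩), ?_, ?_⟩
  · rw [e.symm.map_adj_iff]; simp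
  · intro x hx
    rw [← e.map_adj_iff, RelIso.apply_symm_apply]
    rcases hh : e x with i | i
    · exfalso
      apply hx
      rw [RelIso.eq_symm_apply, hh, Subsingleton.elim i 0]
    · simp

/-- A star map records a star-factor by sending each vertex to the centre of its star; for a star
`K_{1,1}` either end may serve as the centre. The centres are the fixed points. -/
structure IsStarMap {V : Type*} (G : SimpleGraph V) (c : V → V) : Prop where
  idem : ∀ v, c (c v) = c v
  adj : ∀ v, c v ≠ v → G.Adj v (c v)
  leaf : ∀ v, c v = v → ∃ w, w ≠ v ∧ c w = v

section

variable {V : Type*} {G : SimpleGraph V}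

/-- Joining every vertex to its image under a star map gives a star-factor. -/
theorem IsStarMap.exists_isStarFactor [Finite V] {c : V → V} (h : G.IsStarMap c) :
    ∃ S, G.IsStarFactor S ∧ Nat.card S.ConnectedComponent = Nat.card {v // c v = v} := by
  let S : SimpleGraph V := fromRel (fun x y => c x = y)
  have hS : ∀ x y, S.Adj x y ↔ x ≠ y ∧ (c x = y ∨ c y = x) := fun x y => fromRel_adj _ x y
  have hr1 : ∀ x y, S.Adj x y → c x = c y := by
    intro x y hxy
    rcases ((hS x y).1 hxy).2 with h1 | h1
    · rw [← h1, h.idem]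
    · rw [← h1, h.idem]
  have hr2 : ∀ x, S.Reachable x (c x) := by
    intro x
    by_cases hx : c x = x
    · rw [hx]
    · exact Adj.reachable ((hS _ _).2 ⟨Ne.symm hx, Or.inl rfl⟩)
  have hr : ∀ x y, S.Reachable x y ↔ c x = c y := by
    intro x y
    constructor
    · rintro ⟨p⟩
      induction p with
      | nil => rfl
      | cons hadj _ ih => exact (hr1 _ _ hadj).trans ih
    · intro hxy
      exact (hr2 x).trans (hxy ▸ (hr2 y).symm)
  refine ⟨S, ⟨?_, ?_⟩, ?_⟩
  · intro x y hxy
    obtain ⟨hne, h1 | h1⟩ := (hS x y).1 hxy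
    · rw [← h1]; exact h.adj x (by rw [h1]; exact hne.symm)
    · rw [← h1]; exact (h.adj y (by rw [h1]; exact hne)).symm
  · intro C
    induction C using ConnectedComponent.ind with
    | _ v =>
    obtain ⟨w, hw, hwv⟩ := h.leaf (c v) (h.idem v)
    have hm : ∀ x, x ∈ S.connectedComponentMk v ↔ c x = c v := by
      intro x
      exact ConnectedComponent.eq.trans (hr x v)
    refine isStar_of_center _ ⟨c v, (hm _).2 (h.idem v)⟩
      ⟨w, (hm _).2 hwv⟩ (by simpa using hw) ?_
    rintro ⟨x, hx⟩ ⟨y, hy⟩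
    have hx' := (hm x).1 hx
    have hy' := (hm y).1 hy
    change S.Adj x y ↔ _
    rw [hS, hx', hy']
    simp only [ne_eq, Subtype.mk.injEq]
    tauto
  · refine Nat.card_congr (Equiv.ofBijective
      (fun C => ConnectedComponent.lift (fun v => (⟨c v, h.idem v⟩ : {v // c v = v}))
        (fun v w p _ => Subtype.ext ((hr v w).1 ⟨p⟩)) C) ⟨?_, ?_⟩)
    · intro C C'
      induction C using ConnectedComponent.ind with
      | _ v =>
      induction C' using ConnectedComponent.ind with
      | _ w =>
      intro hvw
      exact ConnectedComponent.eq.2 ((hr v w).2 (by simpa using hvw))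
    · rintro ⟨v, hv⟩
      exact ⟨S.connectedComponentMk v, Subtype.ext hv⟩

/-- Every component of a star-factor has a centre `z` and a leaf `w`. -/
theorem IsStarFactor.exists_centers {S : SimpleGraph V} (h : G.IsStarFactor S) :
    ∃ z w : S.ConnectedComponent → V, (∀ C, S.connectedComponentMk (z C) = C) ∧
      (∀ C, S.connectedComponentMk (w C) = C) ∧ (∀ C, G.Adj (z C) (w C)) ∧
      ∀ v, v ≠ z (S.connectedComponentMk v) → G.Adj v (z (S.connectedComponentMk v)) := by
  have h1 := fun C => (h.2 C).exists_center
  choose z w hzw hz using h1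
  refine ⟨fun C => z C, fun C => w C, fun C => (z C).2, fun C => (w C).2, fun C => h.1 (hzw C), ?_⟩
  intro v hv
  exact h.1 (hz (S.connectedComponentMk v) ⟨v, rfl⟩ (fun h' => hv (congrArg Subtype.val h')))

theorem IsStarFactor.exists_isDominatingSet [Finite V] {S : SimpleGraph V} (h : G.IsStarFactor S) :
    ∃ D : Finset V, G.IsDominatingSet D ∧ D.card = Nat.card S.ConnectedComponent := by
  classical
  obtain ⟨z, w, hz, -, -, hd⟩ := h.exists_centers
  have := Fintype.ofFinite S.ConnectedComponent
  refine ⟨Finset.univ.image z, ?_, ?_⟩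
  · intro v
    by_cases hv : v = z (S.connectedComponentMk v)
    · left; rw [hv]; simp
    · right; exact ⟨_, by simp, hd v hv⟩
  · rw [Finset.card_image_of_injective _ (Function.LeftInverse.injective hz),
      Nat.card_eq_fintype_card, Finset.card_univ]

theorem IsStarFactor.card_le_of_cover {S : SimpleGraph V} (h : G.IsStarFactor S) (X : Finset V)
    (hX : ∀ v w, G.Adj v w → v ∈ X ∨ w ∈ X) : Nat.card S.ConnectedComponent ≤ X.card := by
  classical
  obtain ⟨z, w, hz, hw, hzw, -⟩ := h.exists_centers
  have : ∀ C, ∃ x ∈ X, S.connectedComponentMk x = C := by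
    intro C
    rcases hX _ _ (hzw C) with h1 | h1
    · exact ⟨_, h1, hz C⟩
    · exact ⟨_, h1, hw C⟩
  choose x hx hxC using this
  have hc : Nat.card (X : Set V) = X.card := by simp
  rw [← hc]
  exact Nat.card_le_card_of_injective (fun C => (⟨x C, hx C⟩ : (X : Set V)))
    (fun C C' hCC => by
      have := congrArg Subtype.val hCC
      simp only at this
      rw [← hxC C, this, hxC])

theorem IsStarFactor.two_mul_card_le [Fintype V] {S : SimpleGraph V} (h : G.IsStarFactor S) :
    2 * Nat.card S.ConnectedComponent ≤ Fintype.card V := by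
  classical
  obtain ⟨z, w, hz, hw, hzw, -⟩ := h.exists_centers
  have hinj : Function.Injective (Sum.elim z w) := by
    refine Function.Injective.sumElim (Function.LeftInverse.injective hz)
      (Function.LeftInverse.injective hw) ?_
    intro C C' hCC
    have : C = C' := by rw [← hz C, hCC, hw]
    subst this
    exact (hzw C).ne hCC
  have := Nat.card_le_card_of_injective _ hinj
  rw [Nat.card_sum, Nat.card_eq_fintype_card (α := V)] at this
  omega

end

section

variable {V : Type*} [Fintype V] [DecidableEq V] {G : SimpleGraph V}

/-- In a graph without isolated vertices the size of any dominating set is at least the number of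
components of some star-factor. -/
theorem IsDominatingSet.exists_isStarMap (hG : ∀ v, ∃ w, G.Adj v w) {D : Finset V}
    (hD : G.IsDominatingSet D) :
    ∃ c, G.IsStarMap c ∧ (Finset.univ.filter fun v => c v = v).card ≤ D.card := by
  -- Allow stars without leaves, and among all such assignments with few centres minimise first
  -- the number of centres and then the number of centres without leaves.
  let fx : (V → V) → Finset V := fun c => Finset.univ.filter fun v => c v = v
  let ly : (V → V) → Finset V :=
    fun c => Finset.univ.filter fun v => c v = v ∧ ∀ w, c w = v → w = v
  let s : Set (V → V) := {c | (∀ v, c (c v) = c v) ∧ (∀ v, c v ≠ v → G.Adj v (c v)) ∧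
    (fx c).card ≤ D.card}
  have hly : ∀ c, (ly c).card < Fintype.card V + 1 := fun c =>
    Nat.lt_succ_of_le (Finset.card_le_univ _)
  have hfx : ∀ c v, v ∈ fx c ↔ c v = v := fun c v => by simp [fx]
  have hne : s.Nonempty := by
    have h1 : ∀ v, ∃ u, v ∉ D → u ∈ D ∧ G.Adj v u := by
      intro v
      rcases hD v with h | ⟨u, hu, hvu⟩
      · exact ⟨v, fun h' => absurd h h'⟩
      · exact ⟨u, fun _ => ⟨hu, hvu⟩⟩
    choose f hf using h1
    refine ⟨fun v => if v ∈ D then v else f v, ?_, ?_, ?_⟩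
    · intro v
      by_cases h : v ∈ D
      · simp [h]
      · simp [h, (hf v h).1]
    · intro v hv
      by_cases h : v ∈ D
      · simp [h] at hv
      · simpa [h] using (hf v h).2
    · refine Finset.card_le_card ?_
      intro v hv
      rw [hfx] at hv
      by_contra h
      simp only [h, if_false] at hv
      have h2 := hf v h
      rw [hv] at h2
      exact h h2.1
  obtain ⟨c, ⟨hc1, hc2, hc3⟩, hmin⟩ := Set.exists_min_image s
    (fun c => (fx c).card * (Fintype.card V + 1) + (ly c).card) (Set.toFinite _) hne
  have hlt : ∀ c', (∀ v, c' (c' v) = c' v) → (∀ v, c' v ≠ v → G.Adj v (c' v)) →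
      ¬ (fx c').card < (fx c).card := by
    intro c' h1 h2 h3
    have := hmin c' ⟨h1, h2, by omega⟩
    have h4 := hly c'
    have h5 : ((fx c').card + 1) * (Fintype.card V + 1) ≤ (fx c).card * (Fintype.card V + 1) :=
      Nat.mul_le_mul_right _ h3
    rw [add_mul] at h5
    omega
  refine ⟨c, ⟨hc1, hc2, ?_⟩, hc3⟩
  intro x hx
  by_contra hlone
  push Not at hlone
  have hlx : ∀ w, c w = x → w = x := fun w hw => by
    by_contra h; exact hlone w h hw
  obtain ⟨y, hxy⟩ := hG x
  have hyx : y ≠ x := hxy.ne'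
  by_cases hy : c y = y
  · refine hlt (fun v => if v = x then y else c v) ?_ ?_ (Finset.card_lt_card ?_)
    · intro v
      by_cases hv : v = x
      · simp [hv, hyx, hy]
      · have : c v ≠ x := fun h => hv (hlx v h)
        simp [hv, this, hc1]
    · intro v hv
      by_cases hvx : v = x
      · simpa [hvx] using hxy
      · simp only [hvx, if_false] at hv ⊢
        exact hc2 v hv
    · refine (Finset.ssubset_iff_of_subset ?_).2 ⟨x, (hfx _ _).2 hx, fun h => ?_⟩
      · intro v hv
        rw [hfx] at hv ⊢
        by_cases hvx : v = x
        · rw [hvx, hx]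
        · simpa [hvx] using hv
      · rw [hfx] at h
        simp only [if_true] at h
        exact hyx h
  obtain ⟨z, hz⟩ : ∃ z, c y = z := ⟨_, rfl⟩
  have hzy : z ≠ y := fun h => hy (hz.trans h)
  have hzx : z ≠ x := fun h => hyx (hlx y (hz.trans h))
  have hzz : c z = z := by rw [← hz, hc1]
  have hcy : ∀ v, c v ≠ y := fun v h => hy (by rw [← h, hc1])
  by_cases hw : ∃ w, w ≠ z ∧ w ≠ y ∧ c w = z
  · -- `y` is moved from the star of `z`, which keeps a leaf, to the star of `x`.
    obtain ⟨w, hwz, hwy, hcw⟩ := hw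
    let c' : V → V := fun v => if v = y then x else c v
    have hc'y : c' y = x := by simp [c']
    have hc' : ∀ v, v ≠ y → c' v = c v := fun v hv => by simp [c', hv]
    have hf : fx c' = fx c := by
      ext v
      rw [hfx, hfx]
      by_cases hv : v = y
      · subst hv; rw [hc'y, hz]; exact ⟨fun h => absurd h.symm hyx, fun h => absurd h hzy⟩
      · rw [hc' v hv]
    have hl : (ly c').card < (ly c).card := by
      refine Finset.card_lt_card ((Finset.ssubset_iff_of_subset ?_).2 ⟨x, ?_, ?_⟩)
      · intro v hv
        simp only [ly, Finset.mem_filter, Finset.mem_univ, true_and] at hv ⊢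
        have hvy : v ≠ y := by
          rintro rfl; exact hyx (hv.1.symm.trans hc'y)
        refine ⟨by rw [← hc' v hvy]; exact hv.1, fun w' hw' => ?_⟩
        by_cases h : w' = y
        · subst h
          have hvz : v = z := hw'.symm.trans hz
          exact absurd (hv.2 w ((hc' w hwy).trans (hcw.trans hvz.symm))) (hvz ▸ hwz)
        · exact hv.2 w' ((hc' w' h).trans hw')
      · simp only [ly, Finset.mem_filter, Finset.mem_univ, true_and]
        exact ⟨hx, hlx⟩
      · simp only [ly, Finset.mem_filter, Finset.mem_univ, true_and]
        exact fun h => hyx (h.2 y hc'y)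
    have := hmin c' ⟨?_, ?_, by rw [hf]; exact hc3⟩
    · simp only [hf] at this
      omega
    · intro v
      by_cases hv : v = y
      · rw [hv, hc'y, hc' x hyx.symm, hx]
      · rw [hc' v hv, hc' _ (hcy v), hc1]
    · intro v hv
      by_cases h : v = y
      · rw [h, hc'y]; exact hxy.symm
      · rw [hc' v h] at hv ⊢; exact hc2 v hv
  · -- The stars of `x` and `z` are merged into one star with centre `y`.
    push Not at hw
    let c' : V → V := fun v => if v = x ∨ v = z ∨ v = y then y else c v
    have h1 : ∀ v, v = x ∨ v = z ∨ v = y → c' v = y := fun v hv => if_pos hv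
    have h2 : ∀ v, ¬ (v = x ∨ v = z ∨ v = y) → c' v = c v := fun v hv => if_neg hv
    refine hlt c' ?_ ?_ ?_
    · intro v
      by_cases hv : v = x ∨ v = z ∨ v = y
      · rw [h1 v hv, h1 y (by simp)]
      · rw [h2 v hv, h2, hc1]
        rintro (h | h | h)
        · exact hv (Or.inl (hlx v h))
        · by_cases hvz : v = z
          · exact hv (by simp [hvz])
          · by_cases hvy : v = y
            · exact hv (by simp [hvy])
            · exact hw v hvz hvy h
        · exact hcy v h
    · intro v hv
      by_cases h : v = x ∨ v = z ∨ v = y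
      · rw [h1 v h] at hv ⊢
        rcases h with rfl | rfl | rfl
        · exact hxy
        · have := hc2 y hy
          rw [hz] at this
          exact this.symm
        · exact absurd rfl hv
      · rw [h2 v h] at hv ⊢
        exact hc2 v hv
    · have hsub : fx c' ⊆ insert y (((fx c).erase x).erase z) := by
        intro v hv
        rw [hfx] at hv
        by_cases h : v = x ∨ v = z ∨ v = y
        · rw [h1 v h] at hv; simp [hv]
        · rw [h2 v h] at hv
          push Not at h
          simp [hfx, hv, h]
      have h3 := (Finset.card_le_card hsub).trans (Finset.card_insert_le _ _)
      rw [Finset.card_erase_of_mem (by simp [hfx, hzz, hzx]),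
        Finset.card_erase_of_mem (by simp [hfx, hx])] at h3
      have h4 : 1 < (fx c).card :=
        Finset.one_lt_card.2 ⟨x, by simp [hfx, hx], z, by simp [hfx, hzz], hzx.symm⟩
      omega

/-! ### Matchings as involutions -/

/-- A matching, encoded as the involution of the vertex set that swaps the ends of every matching
edge and fixes the unsaturated vertices. -/
structure IsMatchingMap {V : Type*} (G : SimpleGraph V) (σ : V → V) : Prop where
  invol : ∀ v, σ (σ v) = v
  adj : ∀ v, σ v ≠ v → G.Adj v (σ v)

/-- The vertices missed by the matching `σ`. -/
def unsat (σ : V → V) : Finset V := Finset.univ.filter fun v => σ v = v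

@[simp] theorem mem_unsat {σ : V → V} {v : V} : v ∈ unsat σ ↔ σ v = v := by simp [unsat]

/-- A maximum matching: one missing as few vertices as possible. -/
structure IsMaxMatchingMap (G : SimpleGraph V) (σ : V → V) : Prop extends G.IsMatchingMap σ where
  min : ∀ τ, G.IsMatchingMap τ → (unsat σ).card ≤ (unsat τ).card

theorem exists_isMaxMatchingMap (G : SimpleGraph V) : ∃ σ, G.IsMaxMatchingMap σ := by
  obtain ⟨σ, h, hmin⟩ := Set.exists_min_image {σ | G.IsMatchingMap σ} (fun σ => (unsat σ).card)
    (Set.toFinite _) ⟨id, ⟨fun _ => rfl, fun v hv => absurd rfl hv⟩⟩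
  exact ⟨σ, h, hmin⟩

/-- Two adjacent unsaturated vertices could be matched to each other. -/
theorem IsMaxMatchingMap.not_adj {σ : V → V} (h : G.IsMaxMatchingMap σ) {u v : V} (hu : σ u = u)
    (hv : σ v = v) : ¬ G.Adj u v := by
  intro huv
  let τ : V → V := fun x => if x = u then v else if x = v then u else σ x
  have h1 : τ u = v := by simp [τ]
  have h2 : τ v = u := by simp [τ, huv.ne']
  have h3 : ∀ x, x ≠ u → x ≠ v → τ x = σ x := fun x hx hx' => by simp [τ, hx, hx']
  have hne : ∀ x w, σ w = w → x ≠ w → σ x ≠ w := by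
    intro x w hw hx hh
    exact hx (by rw [← h.invol x, hh, hw])
  have hτ : G.IsMatchingMap τ := by
    constructor
    · intro x
      by_cases hx : x = u
      · rw [hx, h1, h2]
      by_cases hx' : x = v
      · rw [hx', h2, h1]
      rw [h3 x hx hx', h3 _ (hne x u hu hx) (hne x v hv hx'), h.invol]
    · intro x hxx
      by_cases hx : x = u
      · rw [hx, h1]; exact huv
      by_cases hx' : x = v
      · rw [hx', h2]; exact huv.symm
      rw [h3 x hx hx'] at hxx ⊢
      exact h.adj x hxx
  refine absurd (h.min τ hτ) (not_le.2 (Finset.card_lt_card ?_))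
  refine (Finset.ssubset_iff_of_subset ?_).2 ⟨u, by simpa using hu, by simpa [h1] using huv.ne'⟩
  intro x hx
  rw [mem_unsat] at hx ⊢
  by_cases hxu : x = u
  · rw [hxu, hu]
  by_cases hxv : x = v
  · rw [hxv, hv]
  rwa [h3 x hxu hxv] at hx

/-- Replacing the matching edge at `a` by an edge from `a` to an unsaturated vertex `d`. -/
theorem IsMaxMatchingMap.rematch {σ : V → V} (h : G.IsMaxMatchingMap σ) {d a : V} (hd : σ d = d)
    (hda : G.Adj d a) : ∃ τ, G.IsMaxMatchingMap τ ∧ τ d = a ∧ τ a = d ∧ τ (σ a) = σ a ∧ σ a ≠ a ∧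
      (∀ v, v ≠ d → v ≠ a → v ≠ σ a → τ v = σ v) := by
  have ha : σ a ≠ a := fun ha => h.not_adj hd ha hda
  have had : σ a ≠ d := fun hh => hda.ne (by rw [← h.invol a, hh, hd])
  let τ : V → V := fun x => if x = d then a else if x = a then d else if x = σ a then x else σ x
  have h1 : τ d = a := by simp [τ]
  have h2 : τ a = d := by simp [τ, hda.ne']
  have h3 : τ (σ a) = σ a := by simp [τ, ha, had]
  have h4 : ∀ v, v ≠ d → v ≠ a → v ≠ σ a → τ v = σ v := fun v h1 h2 h3 => by simp [τ, h1, h2, h3]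
  have hτ : G.IsMatchingMap τ := by
    constructor
    · intro x
      by_cases hx1 : x = d
      · rw [hx1, h1, h2]
      by_cases hx2 : x = a
      · rw [hx2, h2, h1]
      by_cases hx3 : x = σ a
      · rw [hx3, h3, h3]
      rw [h4 x hx1 hx2 hx3, h4, h.invol]
      · exact fun hh => hx1 (by rw [← h.invol x, hh, hd])
      · exact fun hh => hx3 (by rw [← h.invol x, hh])
      · exact fun hh => hx2 (by rw [← h.invol x, hh, h.invol])
    · intro x hx
      by_cases hx1 : x = d
      · rw [hx1, h1]; exact hda
      by_cases hx2 : x = a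
      · rw [hx2, h2]; exact hda.symm
      by_cases hx3 : x = σ a
      · rw [hx3] at hx; exact absurd h3 hx
      rw [h4 x hx1 hx2 hx3] at hx ⊢
      exact h.adj x hx
  refine ⟨τ, ⟨hτ, fun ρ hρ => ?_⟩, h1, h2, h3, ha, h4⟩
  have hsub : unsat τ ⊆ insert (σ a) ((unsat σ).erase d) := by
    intro x hx
    rw [mem_unsat] at hx
    by_cases hx1 : x = d
    · subst hx1; rw [h1] at hx; exact absurd hx hda.ne'
    by_cases hx2 : x = a
    · subst hx2; rw [h2] at hx; exact absurd hx hda.ne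
    by_cases hx3 : x = σ a
    · simp [hx3]
    rw [h4 x hx1 hx2 hx3] at hx
    simp [hx, hx1]
  have hc := (Finset.card_le_card hsub).trans (Finset.card_insert_le _ _)
  rw [Finset.card_erase_add_one (by simpa using hd)] at hc
  exact hc.trans (h.min ρ hρ)

/-- One end of every edge of a maximum matching can be chosen so that a prescribed neighbour of
every unsaturated vertex is chosen: otherwise the matching could be augmented. -/
theorem IsMaxMatchingMap.exists_ends {σ : V → V} (h : G.IsMaxMatchingMap σ) (p : V → V)
    (hp : ∀ u, σ u = u → G.Adj u (p u)) :
    ∃ X : Finset V, (∀ u, σ u = u → u ∉ X ∧ p u ∈ X) ∧ ∀ v, σ v ≠ v → (v ∈ X ↔ σ v ∉ X) := by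
  have hpn : ∀ u, σ u = u → σ (p u) ≠ p u := fun u hu hh => h.not_adj hu hh (hp u hu)
  have haug : ∀ u w, σ u = u → σ w = w → p w ≠ σ (p u) := by
    intro u w hu hw hpw
    by_cases huw : w = u
    · subst huw; exact hpn w hw hpw.symm
    obtain ⟨τ, hτ, h1, h2, h3, h4, h5⟩ := h.rematch hu (hp u hu)
    refine hτ.not_adj (u := w) (v := p w) ?_ (by rw [hpw, h3]) (hp w hw)
    rw [h5 w huw, hw]
    · intro hh; rw [hh] at hw; exact hpn u hu hw
    · rw [← hpw]; exact (hp w hw).ne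
  let e := Fintype.equivFin V
  refine ⟨Finset.univ.filter fun v => σ v ≠ v ∧ ((∃ u, σ u = u ∧ p u = v) ∨
    ((¬ ∃ u, σ u = u ∧ p u = σ v) ∧ e v < e (σ v))), ?_, ?_⟩
  · intro u hu
    simp only [Finset.mem_filter, Finset.mem_univ, true_and]
    exact ⟨fun h' => h'.1 hu, hpn u hu, Or.inl ⟨u, hu, rfl⟩⟩
  · intro v hv
    have hv' : σ (σ v) ≠ σ v := by rw [h.invol]; exact hv.symm
    simp only [Finset.mem_filter, Finset.mem_univ, true_and]
    rw [and_iff_right hv, and_iff_right hv', h.invol]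
    have hlt : ¬ (e (σ v) < e v) ↔ e v < e (σ v) := by
      rw [not_lt, le_iff_lt_or_eq]
      exact or_iff_left (fun hh => hv (e.injective hh).symm)
    have hx : ¬ ((∃ u, σ u = u ∧ p u = v) ∧ ∃ u, σ u = u ∧ p u = σ v) := by
      rintro ⟨⟨u, hu, huv⟩, ⟨w, hw, hwv⟩⟩
      exact haug u w hu hw (by rw [huv, hwv])
    have hlt' : ¬ (e v < e (σ v)) → e (σ v) < e v := fun h' => by
      by_contra h''; exact h' (hlt.1 h'')
    have hlt'' := hlt.2
    clear hv' hlt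
    generalize (∃ u, σ u = u ∧ p u = v) = P at *
    generalize (∃ u, σ u = u ∧ p u = σ v) = Q at *
    generalize (e v < e (σ v)) = R at *
    generalize (e (σ v) < e v) = S at *
    clear hv haug hpn hp h
    tauto

/-- A matching map restricted to an invariant set of vertices saturates twice as many vertices as
it has edges. -/
theorem IsMatchingMap.two_mul_card_ends {σ : V → V} (h : G.IsMatchingMap σ) {X W : Finset V}
    (hX : ∀ u, σ u = u → u ∉ X) (hX' : ∀ v, σ v ≠ v → (v ∈ X ↔ σ v ∉ X))
    (hW : ∀ v ∈ W, σ v ∈ W) : 2 * (X ∩ W).card + (unsat σ ∩ W).card = W.card := by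
  have hσ : Function.Injective σ := Function.LeftInverse.injective h.invol
  have e1 : W = ((X ∩ W) ∪ (X ∩ W).image σ) ∪ (unsat σ ∩ W) := by
    ext v
    simp only [Finset.mem_union, Finset.mem_inter, Finset.mem_image, mem_unsat]
    constructor
    · intro hv
      by_cases h1 : σ v = v
      · exact Or.inr ⟨h1, hv⟩
      · by_cases h2 : v ∈ X
        · exact Or.inl (Or.inl ⟨h2, hv⟩)
        · refine Or.inl (Or.inr ⟨σ v, ⟨?_, hW v hv⟩, h.invol v⟩)
          by_contra h3; exact h2 ((hX' v h1).2 h3)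
    · rintro ((⟨-, hv⟩ | ⟨w, ⟨-, hw⟩, rfl⟩) | ⟨-, hv⟩)
      exacts [hv, hW w hw, hv]
  have hne : ∀ v ∈ X, σ v ≠ v := fun v hv hh => hX v hh hv
  have d1 : Disjoint (X ∩ W) ((X ∩ W).image σ) := by
    rw [Finset.disjoint_left]
    intro v hv hv'
    simp only [Finset.mem_inter, Finset.mem_image] at hv hv'
    obtain ⟨w, ⟨hw, -⟩, rfl⟩ := hv'
    exact (hX' w (hne w hw)).1 hw hv.1
  have d2 : Disjoint ((X ∩ W) ∪ (X ∩ W).image σ) (unsat σ ∩ W) := by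
    rw [Finset.disjoint_left]
    intro v hv hv'
    simp only [Finset.mem_union, Finset.mem_inter, Finset.mem_image, mem_unsat] at hv hv'
    rcases hv with hv | ⟨w, ⟨hw, -⟩, rfl⟩
    · exact hne v hv.1 hv'.1
    · exact hne w hw ((h.invol w).symm.trans hv'.1).symm
  conv_rhs => rw [e1]
  rw [Finset.card_union_of_disjoint d2, Finset.card_union_of_disjoint d1,
    Finset.card_image_of_injective _ hσ]
  ring

/-- Every dominating set has at least as many vertices as a maximum matching has edges. -/
def IsTight (G : SimpleGraph V) : Prop :=
  ∀ σ, G.IsMaxMatchingMap σ → ∀ D : Finset V, G.IsDominatingSet D →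
    Fintype.card V ≤ 2 * D.card + (unsat σ).card

/-- Star-uniformity compares a star-factor centred in a dominating set with one obtained by
attaching the unsaturated vertices to a maximum matching. -/
theorem IsStarUniform.isTight (hU : G.IsStarUniform) (hG : ∀ v, ∃ w, G.Adj v w) :
    G.IsTight := by
  intro σ hσ D hD
  obtain ⟨c, hc, hcD⟩ := hD.exists_isStarMap hG
  choose p hp using hG
  obtain ⟨X, hX1, hX2⟩ := hσ.exists_ends p (fun u _ => hp u)
  have hc' : G.IsStarMap fun v => if σ v = v then p v else if v ∈ X then v else σ v := by
    have key : ∀ v, v ∈ X → (if σ v = v then p v else if v ∈ X then v else σ v) = v := by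
      intro v hv
      rw [if_neg (fun hh => (hX1 v hh).1 hv), if_pos hv]
    constructor
    · intro v
      by_cases h1 : σ v = v
      · rw [if_pos h1]; exact key _ (hX1 v h1).2
      rw [if_neg h1]
      by_cases h2 : v ∈ X
      · rw [if_pos h2]; exact key v h2
      · rw [if_neg h2]
        refine key _ ?_
        by_contra h3; exact h2 ((hX2 v h1).2 h3)
    · intro v hv
      by_cases h1 : σ v = v
      · rw [if_pos h1]; exact hp v
      rw [if_neg h1] at hv ⊢
      by_cases h2 : v ∈ X
      · rw [if_pos h2] at hv; exact absurd rfl hv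
      · rw [if_neg h2]; exact hσ.adj v h1
    · intro v hv
      by_cases h1 : σ v = v
      · rw [if_pos h1] at hv; exact absurd hv (hp v).ne'
      rw [if_neg h1] at hv
      by_cases h2 : v ∈ X
      · refine ⟨σ v, h1, ?_⟩
        rw [hσ.invol, if_neg (Ne.symm h1), if_neg ((hX2 v h1).1 h2)]
      · rw [if_neg h2] at hv; exact absurd hv h1
  obtain ⟨S, hS, hSc⟩ := hc.exists_isStarFactor
  obtain ⟨T, hT, hTc⟩ := hc'.exists_isStarFactor
  have e1 := hU S T hS hT
  rw [hSc, hTc, Nat.card_eq_fintype_card, Nat.card_eq_fintype_card, Fintype.card_subtype,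
    Fintype.card_subtype] at e1
  have e2 : (Finset.univ.filter fun v => (if σ v = v then p v else if v ∈ X then v else σ v) = v)
      = X := by
    ext v
    simp only [Finset.mem_filter, Finset.mem_univ, true_and]
    constructor
    · intro hv
      by_contra h2
      by_cases h1 : σ v = v
      · rw [if_pos h1] at hv; exact (hp v).ne' hv
      · rw [if_neg h1, if_neg h2] at hv; exact h1 hv
    · intro hv
      rw [if_neg (fun hh => (hX1 v hh).1 hv), if_pos hv]
  have e3 := hσ.two_mul_card_ends (W := Finset.univ) (fun u hu => (hX1 u hu).1) hX2 (by simp)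
  rw [Finset.inter_univ, Finset.inter_univ, Finset.card_univ] at e3
  rw [e2] at e1
  omega

/-- The local form of tightness: fewer than half of the saturated vertices of a union `W` of
matching edges and unsaturated vertices cannot dominate `W`, provided the unsaturated vertices
outside `W` can still be dominated. -/
theorem IsTight.card_le (hT : G.IsTight) {σ : V → V} (hσ : G.IsMaxMatchingMap σ) (W E : Finset V)
    (hW : ∀ v ∈ W, σ v ∈ W) (hE : ∀ v ∈ W, v ∈ E ∨ ∃ u ∈ E, G.Adj v u)
    (hG : ∀ v, ∃ w, G.Adj v w)
    (hU : ∀ u, σ u = u → u ∉ W → ∃ w, G.Adj u w ∧ (w ∈ E ∨ w ∉ W)) :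
    W.card ≤ 2 * E.card + (unsat σ ∩ W).card := by
  have h1 : ∀ u, ∃ w, G.Adj u w ∧ (σ u = u → u ∉ W → w ∈ E ∨ w ∉ W) := by
    intro u
    by_cases h : σ u = u ∧ u ∉ W
    · obtain ⟨w, hw, hw'⟩ := hU u h.1 h.2
      exact ⟨w, hw, fun _ _ => hw'⟩
    · obtain ⟨w, hw⟩ := hG u
      exact ⟨w, hw, fun h2 h3 => absurd ⟨h2, h3⟩ h⟩
  choose p hp hp' using h1
  obtain ⟨X, hX1, hX2⟩ := hσ.exists_ends p (fun u _ => hp u)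
  have hWc : ∀ v, σ v ∈ W → v ∈ W := fun v hv => by rw [← hσ.invol v]; exact hW _ hv
  have hD : G.IsDominatingSet (E ∪ (X ∩ Wᶜ)) := by
    intro v
    simp only [Finset.mem_union, Finset.mem_inter, Finset.mem_compl]
    by_cases hv : v ∈ W
    · rcases hE v hv with h | ⟨u, hu, hvu⟩
      · exact Or.inl (Or.inl h)
      · exact Or.inr ⟨u, Or.inl hu, hvu⟩
    by_cases hs : σ v = v
    · right
      rcases hp' v hs hv with h | h
      · exact ⟨p v, Or.inl h, hp v⟩
      · exact ⟨p v, Or.inr ⟨(hX1 v hs).2, h⟩, hp v⟩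
    by_cases hx : v ∈ X
    · exact Or.inl (Or.inr ⟨hx, hv⟩)
    · refine Or.inr ⟨σ v, Or.inr ⟨?_, fun h => hv (hWc v h)⟩, hσ.adj v hs⟩
      by_contra h3; exact hx ((hX2 v hs).2 h3)
  have h2 := hT σ hσ _ hD
  have h3 := hσ.two_mul_card_ends (W := Wᶜ) (fun u hu => (hX1 u hu).1) hX2
    (fun v hv => by simp only [Finset.mem_compl] at hv ⊢; exact fun h => hv (hWc v h))
  have h4 := Finset.card_union_le E (X ∩ Wᶜ)
  have h5 := Finset.card_add_card_compl W
  have h6 : (unsat σ ∩ W).card + (unsat σ ∩ Wᶜ).card = (unsat σ).card := by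
    rw [← Finset.sdiff_eq_inter_compl]; exact Finset.card_inter_add_card_sdiff _ _
  omega

end

section

variable {V : Type*} {G : SimpleGraph V}

/-! ### Bipartite graphs with tight domination -/

theorem dominationNumber_eq [Fintype V] {D : Finset V} (hD : G.IsDominatingSet D)
    (h : ∀ D', G.IsDominatingSet D' → D.card ≤ D'.card) : G.dominationNumber = D.card := by
  refine le_antisymm (Nat.sInf_le ⟨D, hD, rfl⟩) (le_csInf ⟨_, D, hD, rfl⟩ ?_)
  rintro n ⟨D', hD', rfl⟩
  exact h D' hD'

theorem dominationNumber_le [Fintype V] {D : Finset V} (hD : G.IsDominatingSet D) :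
    G.dominationNumber ≤ D.card := Nat.sInf_le ⟨D, hD, rfl⟩

theorem Connected.eq_univ_of_adj_closed (hc : G.Connected) {S : Set V} {v : V} (hv : v ∈ S)
    (h : ∀ x ∈ S, ∀ y, G.Adj x y → y ∈ S) (w : V) : w ∈ S := by
  obtain ⟨p⟩ := hc.preconnected v w
  induction p with
  | nil => exact hv
  | cons hadj _ ih => exact ih (h _ hv _ hadj)

variable [DecidableEq V]

/-- If `X` is a minimum dominating set, replacing two neighbours of `y ∈ Y` by `y` leaves some
vertex undominated, and that vertex closes a 4-cycle. -/
theorem IsBipartiteWith.girth_eq_four [Nonempty V] {X Y : Finset V}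
    (h : G.IsBipartiteWith (X : Set V) (Y : Set V)) (hu : (X : Set V) ∪ (Y : Set V) = Set.univ)
    (hδ : ∀ v a, ∃ w, G.Adj v w ∧ w ≠ a)
    (hmin : ∀ D, G.IsDominatingSet D → X.card ≤ D.card) : G.girth = 4 := by
  have hXY : ∀ v, v ∈ X ∨ v ∈ Y := fun v => by
    have : v ∈ (X : Set V) ∪ (Y : Set V) := hu ▸ Set.mem_univ v
    simpa using this
  have hdis : ∀ v, v ∈ X → v ∉ Y := fun v hx hy =>
    Set.disjoint_left.1 h.disjoint (Finset.mem_coe.2 hx) (Finset.mem_coe.2 hy)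
  have hadj : ∀ {v w}, G.Adj v w → v ∈ Y → w ∈ X := by
    intro v w hvw hv
    rcases h.mem_of_adj hvw with h1 | h1
    · exact absurd hv (hdis v (by simpa using h1.1))
    · simpa using h1.2
  have hadj' : ∀ {v w}, G.Adj v w → v ∈ X → w ∈ Y := by
    intro v w hvw hv
    rcases h.mem_of_adj hvw with h1 | h1
    · simpa using h1.2
    · exact absurd (by simpa using h1.1) (hdis v hv)
  obtain ⟨y, hy⟩ : ∃ y, y ∈ Y := by
    obtain ⟨v⟩ := ‹Nonempty V›
    rcases hXY v with hv | hv
    · obtain ⟨w, hw, -⟩ := hδ v v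
      exact ⟨w, hadj' hw hv⟩
    · exact ⟨v, hv⟩
  obtain ⟨x, hyx, -⟩ := hδ y y
  obtain ⟨x', hyx', hxx'⟩ := hδ y x
  have hx := hadj hyx hy
  have hx' := hadj hyx' hy
  have hnd : ¬ G.IsDominatingSet (insert y ((X.erase x).erase x')) := by
    intro hD
    have h1 := (hmin _ hD).trans (Finset.card_insert_le _ _)
    rw [Finset.card_erase_of_mem (by simp [hx', hxx']), Finset.card_erase_of_mem hx] at h1
    have : 1 < X.card := Finset.one_lt_card.2 ⟨x, hx, x', hx', hxx'.symm⟩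
    omega
  simp only [IsDominatingSet, Finset.mem_insert, Finset.mem_erase, not_forall, not_or,
    not_exists, not_and] at hnd
  obtain ⟨v, ⟨hvy, hvX⟩, hv⟩ := hnd
  have hvX' : v ∉ X := by
    intro hvX1
    by_cases h1 : v = x'
    · exact hv y (Or.inl rfl) (h1 ▸ hyx'.symm)
    by_cases h2 : v = x
    · exact hv y (Or.inl rfl) (h2 ▸ hyx.symm)
    exact hvX h1 h2 hvX1
  have hvY := (hXY v).resolve_left hvX'
  have hnb : ∀ w, G.Adj v w → w = x ∨ w = x' := by
    intro w hvw
    by_contra hcon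
    push Not at hcon
    exact hv w (Or.inr ⟨hcon.2, hcon.1, hadj hvw hvY⟩) hvw
  have hvx : G.Adj v x := by
    obtain ⟨w, hw, hwx⟩ := hδ v x'
    rcases hnb w hw with h1 | h1
    · exact h1 ▸ hw
    · exact absurd h1 hwx
  have hvx' : G.Adj v x' := by
    obtain ⟨w, hw, hwx⟩ := hδ v x
    rcases hnb w hw with h1 | h1
    · exact absurd h1 hwx
    · exact h1 ▸ hw
  let p : G.Walk y y := .cons hyx (.cons hvx.symm (.cons hvx' (.cons hyx'.symm .nil)))
  have hp : p.IsCycle := by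
    rw [Walk.isCycle_def, Walk.isTrail_def]
    refine ⟨?_, by simp [p], ?_⟩
    · have := hyx.ne; have := hvx.ne; have := hvx'.ne; have := hyx'.ne
      have := Ne.symm hvy; have := hxx'.symm
      simp [p]
      grind
    · have := hyx.ne; have := hvx.ne; have := hvx'.ne; have := hyx'.ne
      simp [p]
      grind
  have hle : G.girth ≤ 4 := G.girth_le_length hp
  have hac : ¬ G.IsAcyclic := fun hh => hh p hp
  have h3 := three_le_girth hac
  have hne : G.girth ≠ 3 := by
    intro hg
    obtain ⟨a, q, hq, hql⟩ := exists_girth_eq_length.2 hac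
    have h2 := two_colorable_iff_forall_loop_even.1 h.isBipartite a q
    rw [← hql, hg] at h2
    exact absurd h2 (by decide)
  omega

variable [Fintype V]

/-- The cardinality hypothesis says that a maximum matching has `X.card` edges, so that tightness
makes `X` a minimum dominating set. -/
theorem IsTight.bipartite_of_card_eq [Nonempty V] (hT : G.IsTight) {σ : V → V}
    (hσ : G.IsMaxMatchingMap σ) (hδ : ∀ v a, ∃ w, G.Adj v w ∧ w ≠ a) {X Y : Finset V}
    (h : G.IsBipartiteWith (X : Set V) (Y : Set V)) (hu : (X : Set V) ∪ (Y : Set V) = Set.univ)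
    (hcard : X.card + (unsat σ).card = Y.card) :
    ∃ X Y : Finset V, G.IsBipartiteWith (X : Set V) (Y : Set V) ∧
      (X : Set V) ∪ (Y : Set V) = Set.univ ∧
      G.girth = 4 ∧ G.dominationNumber = X.card ∧ X.card ≤ Y.card := by
  have hn : Fintype.card V = X.card + Y.card := by
    rw [← Finset.card_union_of_disjoint (by exact_mod_cast h.disjoint), ← Finset.card_univ]
    congr 1
    exact (Finset.coe_injective (by push_cast; exact hu)).symm
  have hXY : ∀ v, v ∈ X ∨ v ∈ Y := fun v => by
    have : v ∈ (X : Set V) ∪ (Y : Set V) := hu ▸ Set.mem_univ v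
    simpa using this
  have hmin : ∀ D, G.IsDominatingSet D → X.card ≤ D.card := by
    intro D hD
    have := hT σ hσ D hD
    omega
  have hX : G.IsDominatingSet X := by
    intro v
    rcases hXY v with hv | hv
    · exact Or.inl hv
    · obtain ⟨w, hw, -⟩ := hδ v v
      rcases h.mem_of_adj hw with h1 | h1
      · exact Or.inl (by simpa using h1.1)
      · exact Or.inr ⟨w, by simpa using h1.2, hw⟩
  exact ⟨X, Y, h, hu, h.girth_eq_four hu hδ hmin, dominationNumber_eq hX hmin, by omega⟩

/-- Alternating-path closure without paths: a largest set `R` containing the unsaturated vertices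
such that each `r ∈ R` is missed by a maximum matching agreeing with `σ` away from `R ∪ σ R`. -/
theorem IsMaxMatchingMap.exists_alternating_closure {σ : V → V} (hσ : G.IsMaxMatchingMap σ)
    (hind : ∀ τ ρ u w, G.IsMaxMatchingMap τ → G.IsMaxMatchingMap ρ → τ u = u → ρ w = w →
      ¬ G.Adj u w) :
    ∃ R : Finset V, unsat σ ⊆ R ∧ (∀ r ∈ R, ∃ τ, G.IsMaxMatchingMap τ ∧ τ r = r) ∧
      ∀ d ∈ R, ∀ a, G.Adj d a → σ a ∈ R := by
  let P : Finset V → Prop := fun R => unsat σ ⊆ R ∧ ∀ r ∈ R, ∃ τ, G.IsMaxMatchingMap τ ∧ τ r = r ∧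
    ∀ v, v ∉ R → σ v ∉ R → τ v = σ v
  have hP0 : P (unsat σ) :=
    ⟨subset_rfl, fun r hr => ⟨σ, hσ, mem_unsat.1 hr, fun _ _ _ => rfl⟩⟩
  obtain ⟨R, hR, hmax⟩ := Set.exists_max_image {R | P R} Finset.card (Set.toFinite _) ⟨_, hP0⟩
  refine ⟨R, hR.1, fun r hr => ?_, ?_⟩
  · obtain ⟨τ, h1, h2, -⟩ := hR.2 r hr
    exact ⟨τ, h1, h2⟩
  intro d hd a hda
  by_contra ha
  obtain ⟨τ, hτ, hτd, hτσ⟩ := hR.2 d hd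
  have haR : a ∉ R := by
    intro haR
    obtain ⟨ρ, hρ, hρa, -⟩ := hR.2 a haR
    exact hind τ ρ d a hτ hρ hτd hρa hda
  obtain ⟨ρ, hρ, h1, h2, h3, h4, h5⟩ := hτ.rematch hτd hda
  rw [hτσ a haR ha] at h3 h4 h5
  have hP : P (insert (σ a) R) := by
    refine ⟨hR.1.trans (Finset.subset_insert _ _), fun r hr => ?_⟩
    rw [Finset.mem_insert] at hr
    rcases hr with rfl | hr
    · refine ⟨ρ, hρ, h3, fun v hv hv' => ?_⟩
      rw [Finset.mem_insert, not_or] at hv hv'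
      rw [h5 v, hτσ v hv.2 hv'.2]
      · rintro rfl; exact hv.2 hd
      · rintro rfl; exact hv'.1 rfl
      · exact hv.1
    · obtain ⟨τ', h6, h7, h8⟩ := hR.2 r hr
      refine ⟨τ', h6, h7, fun v hv hv' => ?_⟩
      rw [Finset.mem_insert, not_or] at hv hv'
      exact h8 v hv.2 hv'.2
  have := hmax _ hP
  rw [Finset.card_insert_of_notMem ha] at this
  omega

/-- If no edge joins two vertices that are missed by maximum matchings, and some vertex is missed,
then the alternating closure of the missed vertices is one side of a bipartition. -/
theorem IsTight.bipartite_of_unsat_nonempty (hT : G.IsTight) (hc : G.Connected)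
    (hδ : ∀ v a, ∃ w, G.Adj v w ∧ w ≠ a)
    (hind : ∀ τ ρ u w, G.IsMaxMatchingMap τ → G.IsMaxMatchingMap ρ → τ u = u → ρ w = w →
      ¬ G.Adj u w) {σ : V → V} (hσ : G.IsMaxMatchingMap σ) (hne : (unsat σ).Nonempty) :
    ∃ X Y : Finset V, G.IsBipartiteWith (X : Set V) (Y : Set V) ∧
      (X : Set V) ∪ (Y : Set V) = Set.univ ∧
      G.girth = 4 ∧ G.dominationNumber = X.card ∧ X.card ≤ Y.card := by
  have := hc.nonempty
  have hG : ∀ v, ∃ w, G.Adj v w := fun v => ⟨_, (hδ v v).choose_spec.1⟩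
  obtain ⟨R, hUR, hRm, hRc⟩ := hσ.exists_alternating_closure hind
  have hRi : ∀ r ∈ R, ∀ s ∈ R, ¬ G.Adj r s := by
    intro r hr s hs
    obtain ⟨τ, h1, h2⟩ := hRm r hr
    obtain ⟨ρ, h3, h4⟩ := hRm s hs
    exact hind τ ρ r s h1 h3 h2 h4
  let A : Finset V := Finset.univ.filter fun a => a ∉ R ∧ σ a ∈ R
  have hA : ∀ a, a ∈ A ↔ a ∉ R ∧ σ a ∈ R := fun a => by simp [A]
  have hRA : ∀ r ∈ R, ∀ a, G.Adj r a → a ∈ A := fun r hr a hra =>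
    (hA a).2 ⟨fun ha => hRi r hr a ha hra, hRc r hr a hra⟩
  have hU : ∀ u, σ u = u → u ∈ R := fun u hu => hUR (by simpa using hu)
  have hdisj : Disjoint A R := Finset.disjoint_left.2 fun a ha => ((hA a).1 ha).1
  have hcard : A.card + (unsat σ).card = R.card := by
    have hinj : Function.Injective σ := Function.LeftInverse.injective hσ.invol
    rw [← Finset.card_image_of_injective A hinj, ← Finset.card_union_of_disjoint]
    · congr 1
      ext r
      simp only [Finset.mem_union, Finset.mem_image, mem_unsat]
      constructor
      · rintro (⟨a, ha, rfl⟩ | hr)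
        · exact ((hA a).1 ha).2
        · exact hU r hr
      · intro hr
        by_cases h : σ r = r
        · exact Or.inr h
        · exact Or.inl ⟨σ r, hRA r hr _ (hσ.adj r h), hσ.invol r⟩
    · rw [Finset.disjoint_left]
      intro r hr hr'
      obtain ⟨a, ha, rfl⟩ := Finset.mem_image.1 hr
      rw [mem_unsat, hσ.invol] at hr'
      have h1 := (hA a).1 ha
      rw [← hr'] at h1
      exact h1.1 h1.2
  have hinv : ∀ v ∈ A ∪ R, σ v ∈ A ∪ R := by
    intro v hv
    rw [Finset.mem_union] at hv ⊢
    rcases hv with hv | hv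
    · exact Or.inr ((hA v).1 hv).2
    · by_cases h : σ v = v
      · right; rwa [h]
      · exact Or.inl (hRA v hv _ (hσ.adj v h))
  have hinv' : ∀ v, v ∉ A ∪ R → σ v ∉ A ∪ R := fun v hv hv' =>
    hv (by rw [← hσ.invol v]; exact hinv _ hv')
  have hRdom : ∀ r ∈ R, ∃ a ∈ A, G.Adj r a := fun r hr => by
    obtain ⟨a, ha⟩ := hG r
    exact ⟨a, hRA r hr a ha, ha⟩
  have hUW : ∀ W, A ∪ R ⊆ W → unsat σ ∩ W = unsat σ := fun W hW =>
    Finset.inter_eq_left.2 fun u hu => hW (Finset.mem_union_right _ (hUR hu))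
  have hcW : (A ∪ R).card = 2 * A.card + (unsat σ).card := by
    rw [Finset.card_union_of_disjoint hdisj]; omega
  -- The rest `C` of the graph is perfectly matched; a vertex of `C` adjacent to `A` would make one
  -- matching edge of `C` superfluous for domination.
  have huniv : ∀ v, v ∈ A ∪ R := by
    obtain ⟨u, hu⟩ := hne
    refine hc.eq_univ_of_adj_closed (S := ((A ∪ R : Finset V) : Set V)) (v := u) ?_ ?_
    · simp [hUR hu]
    intro a ha x hax
    rw [Finset.mem_coe] at ha ⊢
    by_contra hx
    have haA : a ∈ A := by
      rcases Finset.mem_union.1 ha with h | h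
      · exact h
      · exact absurd (Finset.mem_union_left _ (hRA a h x hax)) hx
    have hnb : ∀ z w, z ∉ A ∪ R → G.Adj z w → w ∉ R := fun z w hz hzw hw =>
      hz (Finset.mem_union_left _ (hRA w hw z hzw.symm))
    have hny : ∀ z, z ∉ A ∪ R → σ z ≠ z := fun z hz hh =>
      hz (Finset.mem_union_right _ (hU z hh))
    obtain ⟨w, hyw, hwx⟩ := hδ (σ x) x
    have hy := hinv' x hx
    have hyx := hny x hx
    by_cases hw : w ∈ A ∪ R
    · have hwA : w ∈ A := (Finset.mem_union.1 hw).resolve_right (hnb _ _ hy hyw)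
      have hle := hT.card_le hσ ((A ∪ R) ∪ {x, σ x}) A ?_ ?_ hG ?_
      · rw [hUW _ Finset.subset_union_left, Finset.card_union_of_disjoint, hcW,
          Finset.card_pair hyx.symm] at hle
        · omega
        · simp [Finset.disjoint_insert_right, hx, hy]
      · intro v hv
        rw [Finset.mem_union] at hv ⊢
        rcases hv with hv | hv
        · exact Or.inl (hinv v hv)
        · right
          simp only [Finset.mem_insert, Finset.mem_singleton] at hv ⊢
          rcases hv with rfl | rfl
          · exact Or.inr rfl
          · exact Or.inl (hσ.invol _)
      · intro v hv
        simp only [Finset.mem_union, Finset.mem_insert, Finset.mem_singleton] at hv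
        rcases hv with (hv | hv) | rfl | rfl
        · exact Or.inl hv
        · exact Or.inr (hRdom v hv)
        · exact Or.inr ⟨a, haA, hax.symm⟩
        · exact Or.inr ⟨w, hwA, hyw⟩
      · intro u hu hu'
        simp [hU u hu] at hu'
    · have hw' := hinv' w hw
      have hww' := hny w hw
      have h1 : σ w ≠ x := fun hh => hyw.ne (by rw [← hσ.invol w, hh])
      have h2 : σ w ≠ σ x := fun hh => hwx (by rw [← hσ.invol w, hh, hσ.invol])
      have hle := hT.card_le hσ ((A ∪ R) ∪ {x, σ x, w, σ w}) (insert w A) ?_ ?_ hG ?_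
      · have h4 : ({x, σ x, w, σ w} : Finset V).card = 4 := by
          rw [Finset.card_insert_of_notMem, Finset.card_insert_of_notMem,
            Finset.card_pair hww'.symm]
          · simp [hyw.ne, h2.symm]
          · simp [hyx.symm, hwx.symm, h1.symm]
        rw [hUW _ Finset.subset_union_left, Finset.card_union_of_disjoint, hcW, h4,
          Finset.card_insert_of_notMem (fun h => hw (Finset.mem_union_left _ h))] at hle
        · omega
        · simp [Finset.disjoint_insert_right, hx, hy, hw, hw']
      · intro v hv
        rw [Finset.mem_union] at hv ⊢
        rcases hv with hv | hv
        · exact Or.inl (hinv v hv)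
        · right
          simp only [Finset.mem_insert, Finset.mem_singleton] at hv ⊢
          rcases hv with rfl | rfl | rfl | rfl <;> simp [hσ.invol]
      · intro v hv
        simp only [Finset.mem_union, Finset.mem_insert, Finset.mem_singleton] at hv ⊢
        rcases hv with (hv | hv) | rfl | rfl | rfl | rfl
        · exact Or.inl (Or.inr hv)
        · obtain ⟨b, hb, hvb⟩ := hRdom v hv
          exact Or.inr ⟨b, Or.inr hb, hvb⟩
        · exact Or.inr ⟨a, Or.inr haA, hax.symm⟩
        · exact Or.inr ⟨w, Or.inl rfl, hyw⟩
        · exact Or.inl (Or.inl rfl)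
        · exact Or.inr ⟨w, Or.inl rfl, (hσ.adj w hww').symm⟩
      · intro u hu hu'
        simp [hU u hu] at hu'
  -- An edge inside `A` would allow one of its ends to be dropped from the dominating set `A`.
  have hAi : ∀ a ∈ A, ∀ b ∈ A, ¬ G.Adj a b := by
    intro a ha b hb hab
    have hle := hT.card_le hσ (A ∪ R) (A.erase a) hinv ?_ hG ?_
    · rw [hUW _ subset_rfl, hcW, Finset.card_erase_of_mem ha] at hle
      have := Finset.card_pos.2 ⟨a, ha⟩
      omega
    · intro v hv
      rcases Finset.mem_union.1 hv with hv | hv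
      · by_cases hva : v = a
        · exact Or.inr ⟨b, by simp [hb, hab.ne'], hva ▸ hab⟩
        · exact Or.inl (by simp [hv, hva])
      · obtain ⟨w, hw, hwa⟩ := hδ v a
        exact Or.inr ⟨w, by simp [hwa, hRA v hv w hw], hw⟩
    · intro u hu hu'
      exact absurd (huniv u) hu'
  refine hT.bipartite_of_card_eq hσ hδ (X := A) (Y := R) ⟨by exact_mod_cast hdisj, ?_⟩ ?_ hcard
  · intro v w hvw
    simp only [Finset.mem_coe]
    rcases Finset.mem_union.1 (huniv v) with hv | hv
    · rcases Finset.mem_union.1 (huniv w) with hw | hw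
      · exact absurd hvw (hAi v hv w hw)
      · exact Or.inl ⟨hv, hw⟩
    · exact Or.inr ⟨hv, hRA v hv w hvw⟩
  · ext v
    simpa using huniv v

/-- With a perfect matching, tightness forces the 4-cycle: if the ends of a matching edge have
further neighbours in different matching edges, two vertices dominate three matching edges. -/
theorem IsTight.bipartite_of_perfect (hT : G.IsTight) (hc : G.Connected)
    (hδ : ∀ v a, ∃ w, G.Adj v w ∧ w ≠ a) {σ : V → V} (hσ : G.IsMaxMatchingMap σ)
    (hp : ∀ v, σ v ≠ v) :
    ∃ X Y : Finset V, G.IsBipartiteWith (X : Set V) (Y : Set V) ∧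
      (X : Set V) ∪ (Y : Set V) = Set.univ ∧
      G.girth = 4 ∧ G.dominationNumber = X.card ∧ X.card ≤ Y.card := by
  have hG : ∀ v, ∃ w, G.Adj v w := fun v => ⟨_, (hδ v v).choose_spec.1⟩
  have hσa : ∀ v, G.Adj v (σ v) := fun v => hσ.adj v (hp v)
  have hU : unsat σ = ∅ := by ext v; simp [hp v]
  have hinj : Function.Injective σ := Function.LeftInverse.injective hσ.invol
  have hle : ∀ W E : Finset V, (∀ v ∈ W, σ v ∈ W) → (∀ v ∈ W, v ∈ E ∨ ∃ u ∈ E, G.Adj v u) →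
      W.card ≤ 2 * E.card := by
    intro W E h1 h2
    have := hT.card_le hσ W E h1 h2 hG (fun u hu => absurd hu (hp u))
    simpa [hU] using this
  have key : ∀ x c e, G.Adj x c → c ≠ σ x → G.Adj (σ x) e → e ≠ x → e = σ c := by
    intro x c e hxc hcx hxe hex
    have hxy := (hp x).symm
    have hc' := (hp c).symm
    have he' := (hp e).symm
    have h1 : x ≠ c := hxc.ne
    have h2 : σ x ≠ e := hxe.ne
    have h3 : x ≠ σ c := fun h => hcx (by rw [h, hσ.invol])
    have h4 : σ x ≠ σ c := fun h => h1 (hinj h)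
    have h5 : x ≠ σ e := fun h => h2 (by rw [h, hσ.invol])
    have h6 : σ x ≠ σ e := fun h => hex (hinj h).symm
    by_contra hne
    by_cases hec : e = c
    · subst hec
      have := hle {x, σ x, e, σ e} {e} ?_ ?_
      · rw [Finset.card_insert_of_notMem, Finset.card_insert_of_notMem,
          Finset.card_pair he', Finset.card_singleton] at this
        · omega
        · simp [h2, h4]
        · simp [hxy, h1, h3]
      · intro v hv
        simp only [Finset.mem_insert, Finset.mem_singleton] at hv ⊢
        rcases hv with rfl | rfl | rfl | rfl <;> simp [hσ.invol]
      · intro v hv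
        simp only [Finset.mem_insert, Finset.mem_singleton] at hv ⊢
        rcases hv with rfl | rfl | rfl | rfl
        · exact Or.inr ⟨_, rfl, hxc⟩
        · exact Or.inr ⟨_, rfl, hxe⟩
        · exact Or.inl rfl
        · exact Or.inr ⟨_, rfl, (hσa _).symm⟩
    · have h7 : σ c ≠ σ e := fun h => hec (hinj h).symm
      have h8 : c ≠ σ e := fun h => hne (by rw [h, hσ.invol])
      have := hle {x, σ x, c, σ c, e, σ e} {c, e} ?_ ?_
      · rw [Finset.card_insert_of_notMem, Finset.card_insert_of_notMem,
          Finset.card_insert_of_notMem, Finset.card_insert_of_notMem, Finset.card_pair he',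
          Finset.card_pair (Ne.symm hec)] at this
        · omega
        · simp [Ne.symm hne, h7]
        · simp [hc', Ne.symm hec, h8]
        · simp [hcx.symm, h4, h2, h6]
        · simp [hxy, h1, h3, hex.symm, h5]
      · intro v hv
        simp only [Finset.mem_insert, Finset.mem_singleton] at hv ⊢
        rcases hv with rfl | rfl | rfl | rfl | rfl | rfl <;> simp [hσ.invol]
      · intro v hv
        simp only [Finset.mem_insert, Finset.mem_singleton] at hv ⊢
        rcases hv with rfl | rfl | rfl | rfl | rfl | rfl
        · exact Or.inr ⟨_, Or.inl rfl, hxc⟩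
        · exact Or.inr ⟨_, Or.inr rfl, hxe⟩
        · exact Or.inl (Or.inl rfl)
        · exact Or.inr ⟨_, Or.inl rfl, (hσa _).symm⟩
        · exact Or.inl (Or.inr rfl)
        · exact Or.inr ⟨_, Or.inr rfl, (hσa _).symm⟩
  choose π hπ hπ' using fun v => hδ v (σ v)
  have huniq : ∀ x c, G.Adj x c → c ≠ σ x → c = π x := by
    intro x c h1 h2
    obtain ⟨e, he, hex⟩ := hδ (σ x) x
    have e1 := key x c e h1 h2 he hex
    have e2 := key x (π x) e (hπ x) (hπ' x) he hex
    exact hinj (e1.symm.trans e2)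
  have hnb : ∀ x c, G.Adj x c → c = σ x ∨ c = π x := by
    intro x c h
    by_cases h' : c = σ x
    · exact Or.inl h'
    · exact Or.inr (huniq x c h h')
  have hππ : ∀ x, π (π x) = x := by
    intro x
    refine (huniq _ _ (hπ x).symm ?_).symm
    intro h
    have h' := congrArg σ h
    rw [hσ.invol] at h'
    exact hπ' x h'.symm
  have hcomm : ∀ x, π (σ x) = σ (π x) := by
    intro x
    refine key x (π x) (π (σ x)) (hπ x) (hπ' x) (hπ (σ x)) ?_
    intro h
    exact hπ' (σ x) (by rw [h, hσ.invol])
  obtain ⟨x⟩ := hc.nonempty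
  have huniv : ∀ v, v = x ∨ v = σ x ∨ v = π x ∨ v = σ (π x) := by
    refine hc.eq_univ_of_adj_closed (S := {v | v = x ∨ v = σ x ∨ v = π x ∨ v = σ (π x)})
      (Or.inl rfl) ?_
    intro v hv w hvw
    simp only [Set.mem_ofPred_eq] at hv ⊢
    have := hnb v w hvw
    rcases hv with rfl | rfl | rfl | rfl
    · tauto
    · rw [hσ.invol, hcomm] at this; tauto
    · rw [hππ] at this; tauto
    · rw [hσ.invol, hcomm, hππ] at this; tauto
  have h1 : x ≠ σ (π x) := fun h => hπ' x (by
    have := congrArg σ h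
    rw [hσ.invol] at this
    exact this.symm)
  have h2 : σ x ≠ π x := (hπ' x).symm
  have := hc.nonempty
  have hxσ : σ x ≠ x := hp x
  have hxπ : π x ≠ x := (hπ x).ne'
  have hσσ : σ (π x) ≠ π x := hp _
  have hσπ : σ (π x) ≠ σ x := fun h => hxπ (hinj h)
  refine hT.bipartite_of_card_eq hσ hδ (X := {x, σ (π x)}) (Y := {σ x, π x}) ⟨?_, ?_⟩ ?_ ?_
  · rw [Finset.disjoint_coe]
    simp [hxσ, hxπ, hσσ.symm, hσπ.symm]
  · intro v w hvw
    have hw := hnb v w hvw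
    simp only [Finset.coe_insert, Finset.coe_singleton, Set.mem_insert_iff,
      Set.mem_singleton_iff]
    rcases huniv v with rfl | rfl | rfl | rfl
    · tauto
    · rw [hσ.invol, hcomm] at hw; tauto
    · rw [hππ] at hw; tauto
    · rw [hσ.invol, hcomm, hππ] at hw; tauto
  · ext v
    have := huniv v
    simp only [Finset.coe_insert, Finset.coe_singleton, Set.mem_union, Set.mem_insert_iff,
      Set.mem_singleton_iff, Set.mem_univ, iff_true]
    tauto
  · rw [hU, Finset.card_pair h1, Finset.card_pair h2]; simp

end

section

variable {V : Type*} [Fintype V] [DecidableEq V] {G : SimpleGraph V}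

/-! ### Odd cycles alternating with a maximum matching -/

/-- Exchanging two maximum matchings on a set invariant under both gives maximum matchings. -/
theorem IsMaxMatchingMap.mix {σ τ : V → V} (hσ : G.IsMaxMatchingMap σ) (hτ : G.IsMaxMatchingMap τ)
    (C : Finset V) (h1 : ∀ v ∈ C, σ v ∈ C) (h2 : ∀ v ∈ C, τ v ∈ C) :
    G.IsMaxMatchingMap fun v => if v ∈ C then σ v else τ v := by
  have key : ∀ {σ τ : V → V}, G.IsMatchingMap σ → G.IsMatchingMap τ → (∀ v ∈ C, σ v ∈ C) →
      (∀ v ∈ C, τ v ∈ C) → G.IsMatchingMap fun v => if v ∈ C then σ v else τ v := by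
    intro σ τ hσ hτ h1 h2
    constructor
    · intro v
      by_cases hv : v ∈ C
      · simp [hv, h1 v hv, hσ.invol]
      · have : τ v ∉ C := fun h => hv (by rw [← hτ.invol v]; exact h2 _ h)
        simp [hv, this, hτ.invol]
    · intro v hv
      by_cases h : v ∈ C
      · simp only [h, if_true] at hv ⊢; exact hσ.adj v hv
      · simp only [h, if_false] at hv ⊢; exact hτ.adj v hv
  have hcard : ∀ σ τ : V → V, (unsat fun v => if v ∈ C then σ v else τ v).card =
      (unsat σ ∩ C).card + (unsat τ \ C).card := by
    intro σ τ
    rw [← Finset.card_union_of_disjoint]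
    · congr 1
      ext v
      by_cases hv : v ∈ C <;> simp [hv]
    · exact Finset.disjoint_left.2 fun v hv hv' => by simp_all
  refine ⟨key hσ.1 hτ.1 h1 h2, fun ρ hρ => ?_⟩
  have h3 := hσ.min _ (key hτ.1 hσ.1 h2 h1)
  have h4 := hσ.min ρ hρ
  have h5 := hτ.min _ hσ.1
  have h6 := Finset.card_inter_add_card_sdiff (unsat σ) C
  have h7 := Finset.card_inter_add_card_sdiff (unsat τ) C
  rw [hcard] at h3 ⊢
  omega

/-- An odd cycle `q 0, …, q (2 * j)` of `G` on which the maximum matching `σ` consists of the edges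
`q 1 q 2, q 3 q 4, …` and misses `q 0`. -/
structure IsFlower (G : SimpleGraph V) (σ : V → V) (j : ℕ) (q : ℕ → V) : Prop where
  max : G.IsMaxMatchingMap σ
  inj : ∀ i k, i ≤ 2 * j → k ≤ 2 * j → q i = q k → i = k
  adj : ∀ i < 2 * j, G.Adj (q i) (q (i + 1))
  adj_last : G.Adj (q (2 * j)) (q 0)
  base : σ (q 0) = q 0
  mate : ∀ i < j, σ (q (2 * i + 1)) = q (2 * i + 2)

/-- The vertices of the cycle `q 0, …, q (2 * j)`. -/
def cycleVerts (j : ℕ) (q : ℕ → V) : Finset V := (Finset.range (2 * j + 1)).image q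

omit [Fintype V] in
theorem mem_cycleVerts {j : ℕ} {q : ℕ → V} {v : V} :
    v ∈ cycleVerts j q ↔ ∃ k ≤ 2 * j, q k = v := by
  simp [cycleVerts]

namespace IsFlower

variable {σ : V → V} {j : ℕ} {q : ℕ → V}

theorem one_le (h : G.IsFlower σ j q) : 1 ≤ j := by
  rcases Nat.eq_zero_or_pos j with rfl | h'
  · exact absurd h.adj_last (G.loopless.irrefl _)
  · exact h'

theorem mate' (h : G.IsFlower σ j q) {i : ℕ} (hi : i < j) : σ (q (2 * i + 2)) = q (2 * i + 1) := by
  rw [← h.mate i hi, h.max.invol]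

theorem card_cycleVerts (h : G.IsFlower σ j q) : (cycleVerts j q).card = 2 * j + 1 := by
  rw [cycleVerts, Finset.card_image_of_injOn, Finset.card_range]
  intro i hi k hk hik
  simp only [Finset.coe_range, Set.mem_Iio] at hi hk
  exact h.inj i k (by omega) (by omega) hik

theorem map_mem (h : G.IsFlower σ j q) {v : V} (hv : v ∈ cycleVerts j q) :
    σ v ∈ cycleVerts j q := by
  rw [mem_cycleVerts] at hv ⊢
  obtain ⟨k, hk, rfl⟩ := hv
  obtain ⟨i, rfl | rfl⟩ : ∃ i, k = 2 * i ∨ k = 2 * i + 1 := ⟨k / 2, by omega⟩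
  · rcases i with - | i
    · exact ⟨0, by omega, h.base.symm⟩
    · exact ⟨2 * i + 1, by omega, (h.mate' (by omega)).symm⟩
  · exact ⟨2 * i + 2, by omega, (h.mate i (by omega)).symm⟩

theorem map_notMem (h : G.IsFlower σ j q) {v : V} (hv : v ∉ cycleVerts j q) :
    σ v ∉ cycleVerts j q := fun h' => hv (by rw [← h.max.invol v]; exact h.map_mem h')

theorem eq_base (h : G.IsFlower σ j q) {v : V} (hv : v ∈ cycleVerts j q) (hσ : σ v = v) :
    v = q 0 := by
  obtain ⟨k, hk, rfl⟩ := mem_cycleVerts.1 hv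
  obtain ⟨i, rfl | rfl⟩ : ∃ i, k = 2 * i ∨ k = 2 * i + 1 := ⟨k / 2, by omega⟩
  · rcases i with - | i
    · rfl
    · rw [show 2 * (i + 1) = 2 * i + 2 by ring, h.mate' (by omega)] at hσ
      have := h.inj _ _ (by omega) (by omega) hσ
      omega
  · rw [h.mate i (by omega)] at hσ
    have := h.inj _ _ (by omega) (by omega) hσ
    omega

theorem base_mem (_ : G.IsFlower σ j q) : q 0 ∈ cycleVerts j q :=
  mem_cycleVerts.2 ⟨0, by omega, rfl⟩

theorem reflect (h : G.IsFlower σ j q) :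
    G.IsFlower σ j (fun k => if k = 0 then q 0 else q (2 * j + 1 - k)) := by
  have hj := h.one_le
  refine ⟨h.max, ?_, ?_, ?_, by simpa using h.base, ?_⟩
  · intro i k hi hk hik
    by_cases h1 : i = 0 <;> by_cases h2 : k = 0
    · omega
    · simp only [h1, h2, if_true, if_false] at hik
      have := h.inj _ _ (by omega) (by omega) hik
      omega
    · simp only [h1, h2, if_true, if_false] at hik
      have := h.inj _ _ (by omega) (by omega) hik
      omega
    · simp only [h1, h2, if_false] at hik
      have := h.inj _ _ (by omega) (by omega) hik
      omega
  · intro i hi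
    by_cases h1 : i = 0
    · subst h1
      simpa using h.adj_last.symm
    · simp only [h1, if_false, Nat.succ_ne_zero]
      have := h.adj (2 * j - i) (by omega)
      rw [show 2 * j - i + 1 = 2 * j + 1 - i by omega] at this
      rw [show 2 * j + 1 - (i + 1) = 2 * j - i by omega]
      exact this.symm
  · rw [if_neg (by omega), if_pos rfl, show 2 * j + 1 - 2 * j = 1 by omega]
    exact (h.adj 0 (by omega)).symm
  · intro i hi
    rw [if_neg (by omega), if_neg (by omega)]
    have := h.mate' (i := j - i - 1) (by omega)
    rw [show 2 * (j - i - 1) + 2 = 2 * j + 1 - (2 * i + 1) by omega,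
      show 2 * (j - i - 1) + 1 = 2 * j + 1 - (2 * i + 2) by omega] at this
    exact this

omit [Fintype V] in
theorem reflect_verts (j : ℕ) (q : ℕ → V) :
    cycleVerts j (fun k => if k = 0 then q 0 else q (2 * j + 1 - k)) = cycleVerts j q := by
  ext v
  simp only [mem_cycleVerts]
  constructor
  · rintro ⟨k, hk, rfl⟩
    by_cases h1 : k = 0
    · exact ⟨0, by omega, by simp [h1]⟩
    · exact ⟨2 * j + 1 - k, by omega, by simp [h1]⟩
  · rintro ⟨k, hk, rfl⟩
    by_cases h1 : k = 0
    · exact ⟨0, by omega, by simp [h1]⟩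
    · refine ⟨2 * j + 1 - k, by omega, ?_⟩
      rw [if_neg (by omega), show 2 * j + 1 - (2 * j + 1 - k) = k by omega]

/-- Moving the base of a flower two steps along the cycle. -/
theorem rotate_two (h : G.IsFlower σ j q) : ∃ τ q', G.IsFlower τ j q' ∧
    (∀ k, k + 2 ≤ 2 * j → q' k = q (k + 2)) ∧ cycleVerts j q' = cycleVerts j q ∧
    ∀ v, v ∉ cycleVerts j q → τ v = σ v := by
  have hj := h.one_le
  obtain ⟨τ, hτ, h1, h2, h3, h4, h5⟩ := h.max.rematch h.base (h.adj 0 (by omega))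
  have hm := h.mate 0 hj
  simp only [mul_zero, zero_add] at hm h1 h2 h3 h4 h5
  rw [hm] at h3 h4 h5
  let q' : ℕ → V := fun k => if k + 2 ≤ 2 * j then q (k + 2) else q (k + 1 - 2 * j)
  have e1 : ∀ k, k + 2 ≤ 2 * j → q' k = q (k + 2) := fun k hk => if_pos hk
  have e2 : ∀ k, ¬ k + 2 ≤ 2 * j → q' k = q (k + 1 - 2 * j) := fun k hk => if_neg hk
  refine ⟨τ, q', ⟨hτ, ?_, ?_, ?_, ?_, ?_⟩, e1, ?_, ?_⟩
  · intro i k hi hk hik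
    by_cases a : i + 2 ≤ 2 * j <;> by_cases b : k + 2 ≤ 2 * j
    · rw [e1 _ a, e1 _ b] at hik
      have := h.inj _ _ (by omega) (by omega) hik
      omega
    · rw [e1 _ a, e2 _ b] at hik
      have := h.inj _ _ (by omega) (by omega) hik
      omega
    · rw [e2 _ a, e1 _ b] at hik
      have := h.inj _ _ (by omega) (by omega) hik
      omega
    · rw [e2 _ a, e2 _ b] at hik
      have := h.inj _ _ (by omega) (by omega) hik
      omega
  · intro i hi
    by_cases a : i + 1 + 2 ≤ 2 * j
    · rw [e1 i (by omega), e1 _ a]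
      exact h.adj (i + 2) (by omega)
    by_cases b : i + 2 ≤ 2 * j
    · rw [e1 i b, e2 _ a, show i + 1 + 1 - 2 * j = 0 by omega, show i + 2 = 2 * j by omega]
      exact h.adj_last
    · rw [e2 i b, e2 _ a, show i + 1 + 1 - 2 * j = (i + 1 - 2 * j) + 1 by omega]
      exact h.adj _ (by omega)
  · rw [e1 0 (by omega), e2 (2 * j) (by omega), show 2 * j + 1 - 2 * j = 1 by omega]
    exact h.adj 1 (by omega)
  · rw [e1 0 (by omega)]; exact h3
  · intro i hi
    by_cases a : 2 * i + 2 + 2 ≤ 2 * j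
    · rw [e1 _ a, e1 _ (by omega), h5]
      · exact h.mate (i + 1) (by omega)
      all_goals
        intro hh
        have := h.inj _ _ (by omega) (by omega) hh
        omega
    · rw [e2 _ a, e2 _ (by omega), show 2 * i + 1 + 1 - 2 * j = 0 by omega,
        show 2 * i + 2 + 1 - 2 * j = 1 by omega]
      exact h1
  · ext v
    simp only [mem_cycleVerts]
    constructor
    · rintro ⟨k, hk, rfl⟩
      by_cases a : k + 2 ≤ 2 * j
      · exact ⟨k + 2, a, (e1 k a).symm⟩
      · exact ⟨k + 1 - 2 * j, by omega, (e2 k a).symm⟩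
    · rintro ⟨k, hk, rfl⟩
      by_cases a : 2 ≤ k
      · exact ⟨k - 2, by omega, by rw [e1 _ (by omega), show k - 2 + 2 = k by omega]⟩
      · exact ⟨k + 2 * j - 1, by omega, by
          rw [e2 _ (by omega), show k + 2 * j - 1 + 1 - 2 * j = k by omega]⟩
  · intro v hv
    have hne : ∀ k ≤ 2 * j, v ≠ q k := fun k hk hh => hv (mem_cycleVerts.2 ⟨k, hk, hh.symm⟩)
    exact h5 v (hne 0 (by omega)) (hne 1 (by omega)) (hne 2 (by omega))

theorem rotate_even (h : G.IsFlower σ j q) (i : ℕ) (hi : i ≤ j) : ∃ τ q', G.IsFlower τ j q' ∧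
    (∀ k, k + 2 * i ≤ 2 * j → q' k = q (k + 2 * i)) ∧ cycleVerts j q' = cycleVerts j q ∧
    ∀ v, v ∉ cycleVerts j q → τ v = σ v := by
  induction i with
  | zero => exact ⟨σ, q, h, fun k _ => rfl, rfl, fun _ _ => rfl⟩
  | succ i ih =>
    obtain ⟨τ, q', h1, h2, h3, h4⟩ := ih (by omega)
    obtain ⟨τ', q'', h5, h6, h7, h8⟩ := h1.rotate_two
    refine ⟨τ', q'', h5, fun k hk => ?_, h7.trans h3, fun v hv => ?_⟩
    · rw [h6 k (by omega), h2 _ (by omega), show k + 2 + 2 * i = k + 2 * (i + 1) by ring]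
    · rw [h8 v (by rwa [h3]), h4 v hv]

/-- Every vertex of the cycle can serve as the base. -/
theorem rebase (h : G.IsFlower σ j q) {c : V} (hc : c ∈ cycleVerts j q) : ∃ τ q',
    G.IsFlower τ j q' ∧ q' 0 = c ∧ cycleVerts j q' = cycleVerts j q ∧
    ∀ v, v ∉ cycleVerts j q → τ v = σ v := by
  obtain ⟨k, hk, rfl⟩ := mem_cycleVerts.1 hc
  obtain ⟨i, rfl | rfl⟩ : ∃ i, k = 2 * i ∨ k = 2 * i + 1 := ⟨k / 2, by omega⟩
  · obtain ⟨τ, q', h1, h2, h3, h4⟩ := h.rotate_even i (by omega)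
    exact ⟨τ, q', h1, by rw [h2 0 (by omega), zero_add], h3, h4⟩
  · obtain ⟨τ, q', h1, h2, h3, h4⟩ := h.reflect.rotate_even (j - i) (by omega)
    rw [reflect_verts] at h3 h4
    refine ⟨τ, q', h1, ?_, h3, h4⟩
    rw [h2 0 (by omega), if_neg (by omega)]
    congr 1
    omega

/-- An unsaturated vertex off the cycle has no neighbour on it: rebasing would augment. -/
theorem not_adj (h : G.IsFlower σ j q) {u c : V} (hu : σ u = u) (huC : u ∉ cycleVerts j q)
    (hc : c ∈ cycleVerts j q) : ¬ G.Adj u c := by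
  obtain ⟨τ, q', h1, h2, h3, h4⟩ := h.rebase hc
  exact h1.max.not_adj (by rw [h4 u huC, hu]) (h2 ▸ h1.base)

/-- Every other vertex of the cycle, from the base on and leaving out the last, dominates it. -/
theorem dominates_even (h : G.IsFlower σ j q) :
    ∀ v ∈ cycleVerts j q, v ∈ (Finset.range j).image (fun i => q (2 * i)) ∨
      ∃ u ∈ (Finset.range j).image (fun i => q (2 * i)), G.Adj v u := by
  intro v hv
  have hj := h.one_le
  obtain ⟨k, hk, rfl⟩ := mem_cycleVerts.1 hv
  simp only [Finset.mem_image, Finset.mem_range]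
  obtain ⟨i, rfl | rfl⟩ : ∃ i, k = 2 * i ∨ k = 2 * i + 1 := ⟨k / 2, by omega⟩
  · by_cases hi : i < j
    · exact Or.inl ⟨i, hi, rfl⟩
    · obtain rfl : i = j := by omega
      exact Or.inr ⟨q 0, ⟨0, hj, rfl⟩, h.adj_last⟩
  · exact Or.inr ⟨q (2 * i), ⟨i, by omega, rfl⟩, (h.adj (2 * i) (by omega)).symm⟩

/-- A matching edge off the cycle whose ends are adjacent to the consecutive vertices `q 0` and
`q (2 * j)` can be inserted between them. -/
theorem extend (h : G.IsFlower σ j q) {z : V} (hz : z ∉ cycleVerts j q) (hzσ : σ z ≠ z)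
    (hz0 : G.Adj (q 0) z) (hz' : G.Adj (q (2 * j)) (σ z)) : ∃ q', G.IsFlower σ (j + 1) q' := by
  have hz1 := h.map_notMem hz
  have hne : ∀ k ≤ 2 * j, q k ≠ z := fun k hk hh => hz (mem_cycleVerts.2 ⟨k, hk, hh⟩)
  have hne' : ∀ k ≤ 2 * j, q k ≠ σ z := fun k hk hh => hz1 (mem_cycleVerts.2 ⟨k, hk, hh⟩)
  let q' : ℕ → V := fun k => if k ≤ 2 * j then q k else if k = 2 * j + 1 then σ z else z
  have e1 : ∀ k, k ≤ 2 * j → q' k = q k := fun k hk => if_pos hk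
  have e2 : q' (2 * j + 1) = σ z := by simp [q']
  have e3 : q' (2 * j + 2) = z := by simp [q']
  refine ⟨q', h.max, ?_, ?_, ?_, ?_, ?_⟩
  · have key : ∀ i k, i < k → k ≤ 2 * (j + 1) → q' i ≠ q' k := by
      intro i k hik hk
      by_cases a : k ≤ 2 * j
      · rw [e1 k a, e1 i (by omega)]
        intro hh
        have := h.inj _ _ (by omega) a hh
        omega
      by_cases b : k = 2 * j + 1
      · rw [b, e2, e1 i (by omega)]; exact hne' i (by omega)
      · rw [show k = 2 * j + 2 by omega, e3]
        by_cases c : i ≤ 2 * j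
        · rw [e1 i c]; exact hne i c
        · rw [show i = 2 * j + 1 by omega, e2]; exact hzσ
    intro i k hi hk hik
    rcases lt_trichotomy i k with hlt | heq | hlt
    · exact absurd hik (key i k hlt hk)
    · exact heq
    · exact absurd hik.symm (key k i hlt hi)
  · intro i hi
    by_cases a : i + 1 ≤ 2 * j
    · rw [e1 i (by omega), e1 _ a]; exact h.adj i (by omega)
    by_cases b : i = 2 * j
    · rw [b, e1 _ le_rfl, e2]; exact hz'
    · rw [show i = 2 * j + 1 by omega, e2, e3]
      exact (h.max.adj z hzσ).symm
  · rw [show 2 * (j + 1) = 2 * j + 2 by ring, e3, e1 0 (by omega)]; exact hz0.symm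
  · rw [e1 0 (by omega)]; exact h.base
  · intro i hi
    by_cases a : i < j
    · rw [e1 _ (by omega), e1 _ (by omega)]; exact h.mate i a
    · rw [show 2 * i + 1 = 2 * j + 1 by omega, show 2 * i + 2 = 2 * j + 2 by omega, e2, e3,
        h.max.invol]

theorem unsat_inter (h : G.IsFlower σ j q) {W : Finset V} (hC : cycleVerts j q ⊆ W)
    (hW : ∀ v ∈ W, σ v = v → v ∈ cycleVerts j q) : (unsat σ ∩ W).card = 1 := by
  rw [Finset.card_eq_one]
  refine ⟨q 0, ?_⟩
  ext v
  simp only [Finset.mem_inter, mem_unsat, Finset.mem_singleton]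
  constructor
  · rintro ⟨h1, h2⟩
    exact h.eq_base (hW v h2 h1) h1
  · rintro rfl
    exact ⟨h.base, hC h.base_mem⟩

/-- In a tight graph of minimum degree at least two, a longest flower is everything. Otherwise a
matching edge `z, σ z` attached at the base leads to a set dominated too cheaply. -/
theorem spanning (hT : G.IsTight) (hc : G.Connected) (hδ : ∀ v a, ∃ w, G.Adj v w ∧ w ≠ a)
    (h : G.IsFlower σ j q) (hmax : ∀ τ i q', G.IsFlower τ i q' → i ≤ j) :
    ∀ v, v ∈ cycleVerts j q := by
  have hG : ∀ v, ∃ w, G.Adj v w := fun v => ⟨_, (hδ v v).choose_spec.1⟩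
  refine hc.eq_univ_of_adj_closed (S := ((cycleVerts j q : Finset V) : Set V)) h.base_mem ?_
  intro c hcC z hcz
  rw [Finset.mem_coe] at hcC ⊢
  by_contra hz
  -- The matching is changed so that the cycle is based at the attachment vertex `c`.
  obtain ⟨σ, q', h', rfl, hC, -⟩ := h.rebase hcC
  clear h
  rw [← hC] at hz
  clear hC hcC
  generalize q' = q at *
  rename' h' => h
  have hzσ : σ z ≠ z := fun hh => h.not_adj hh hz h.base_mem hcz.symm
  have hz' := h.map_notMem hz
  have hu0 : ∀ u, u ∉ cycleVerts j q → u ≠ q 0 := fun u hu hh => hu (hh ▸ h.base_mem)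
  obtain ⟨τ, hτ, -, -, t3, -, t5⟩ := h.max.rematch h.base hcz
  have hτu : ∀ u, σ u = u → u ∉ cycleVerts j q → τ u = u := by
    intro u hu huC
    rw [t5 u (hu0 u huC), hu]
    · rintro rfl; exact hzσ hu
    · rintro rfl; rw [h.max.invol] at hu; exact hzσ hu.symm
  have huz' : ∀ u, σ u = u → u ∉ cycleVerts j q → ¬ G.Adj u (σ z) :=
    fun u hu huC => hτ.not_adj (hτu u hu huC) t3
  have hEc : ((Finset.range j).image (fun i => q (2 * i))).card ≤ j :=
    Finset.card_image_le.trans (by simp)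
  have h0E : q 0 ∈ (Finset.range j).image (fun i => q (2 * i)) :=
    Finset.mem_image.2 ⟨0, Finset.mem_range.2 h.one_le, rfl⟩
  obtain ⟨w, hzw, hwz⟩ := hδ (σ z) z
  by_cases hw : w ∈ cycleVerts j q
  · have key : ∀ q : ℕ → V, G.IsFlower σ j q → z ∉ cycleVerts j q → G.Adj (q 0) z →
        (∀ u, σ u = u → u ∉ cycleVerts j q → ¬ G.Adj u (σ z)) →
        ∀ i ≤ j, ¬ G.Adj (σ z) (q (2 * i)) := by
      intro q h hz hqz huz' i hi hzi
      have hz' := h.map_notMem hz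
      have hEc : ((Finset.range j).image (fun i => q (2 * i))).card ≤ j :=
        Finset.card_image_le.trans (by simp)
      have h0E : q 0 ∈ (Finset.range j).image (fun i => q (2 * i)) :=
        Finset.mem_image.2 ⟨0, Finset.mem_range.2 h.one_le, rfl⟩
      by_cases hij : i = j
      · subst hij
        obtain ⟨q'', h''⟩ := h.extend hz hzσ hqz hzi.symm
        have := hmax _ _ _ h''
        omega
      have hle := hT.card_le h.max (cycleVerts j q ∪ {z, σ z})
        ((Finset.range j).image (fun i => q (2 * i))) ?_ ?_ hG ?_
      · rw [h.unsat_inter Finset.subset_union_left, Finset.card_union_of_disjoint,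
          h.card_cycleVerts, Finset.card_pair hzσ.symm] at hle
        · omega
        · simp [Finset.disjoint_insert_right, hz, hz']
        · intro v hv hvσ
          simp only [Finset.mem_union, Finset.mem_insert, Finset.mem_singleton] at hv
          rcases hv with hv | rfl | rfl
          · exact hv
          · exact absurd hvσ hzσ
          · rw [h.max.invol] at hvσ; exact absurd hvσ.symm hzσ
      · intro v hv
        simp only [Finset.mem_union, Finset.mem_insert, Finset.mem_singleton] at hv ⊢
        rcases hv with hv | rfl | rfl
        · exact Or.inl (h.map_mem hv)
        · simp
        · simp [h.max.invol]
      · intro v hv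
        simp only [Finset.mem_union, Finset.mem_insert, Finset.mem_singleton] at hv
        rcases hv with hv | rfl | rfl
        · exact h.dominates_even v hv
        · exact Or.inr ⟨_, h0E, hqz.symm⟩
        · exact Or.inr ⟨_, Finset.mem_image.2 ⟨i, by simp; omega, rfl⟩, hzi⟩
      · intro u hu huW
        simp only [Finset.mem_union, Finset.mem_insert, Finset.mem_singleton, not_or] at huW
        obtain ⟨x, hux, hxz⟩ := hδ u z
        refine ⟨x, hux, Or.inr ?_⟩
        simp only [Finset.mem_union, Finset.mem_insert, Finset.mem_singleton, not_or]
        exact ⟨fun hx => h.not_adj hu huW.1 hx hux, hxz, fun hx => huz' u hu huW.1 (hx ▸ hux)⟩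
    obtain ⟨k, hk, rfl⟩ := mem_cycleVerts.1 hw
    obtain ⟨i, rfl | rfl⟩ : ∃ i, k = 2 * i ∨ k = 2 * i + 1 := ⟨k / 2, by omega⟩
    · exact key q h hz hcz huz' i (by omega) hzw
    · refine key _ h.reflect ?_ ?_ ?_ (j - i) (by omega) ?_
      · rwa [reflect_verts]
      · simpa using hcz
      · rwa [reflect_verts]
      · rw [if_neg (by omega), show 2 * j + 1 - 2 * (j - i) = 2 * i + 1 by omega]
        exact hzw
  · have hwσ : σ w ≠ w := fun hh => huz' w hh hw hzw.symm
    have hw' := h.map_notMem hw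
    have h1 : σ w ≠ z := fun hh => hzw.ne (by rw [← hh, h.max.invol])
    have h2 : σ w ≠ σ z := fun hh => hwz (by rw [← h.max.invol w, hh, h.max.invol])
    have hτw : τ w = σ w := t5 w (hu0 w hw) hwz hzw.ne'
    obtain ⟨ρ, hρ, -, -, r3, -, r5⟩ := hτ.rematch t3 hzw
    rw [hτw] at r3 r5
    have huw' : ∀ u, σ u = u → u ∉ cycleVerts j q → ¬ G.Adj u (σ w) := by
      intro u hu huC
      refine hρ.not_adj ?_ r3
      rw [r5, hτu u hu huC]
      · rintro rfl; rw [h.max.invol] at hu; exact hzσ hu.symm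
      · rintro rfl; exact hwσ hu
      · rintro rfl; rw [h.max.invol] at hu; exact hwσ hu.symm
    have hle := hT.card_le h.max (cycleVerts j q ∪ {z, σ z, w, σ w})
        (insert w ((Finset.range j).image (fun i => q (2 * i)))) ?_ ?_ hG ?_
    · have h4 : ({z, σ z, w, σ w} : Finset V).card = 4 := by
        rw [Finset.card_insert_of_notMem, Finset.card_insert_of_notMem,
          Finset.card_pair hwσ.symm]
        · simp [hzw.ne, h2.symm]
        · simp [hzσ.symm, hwz.symm, h1.symm]
      have h5 := Finset.card_insert_le w ((Finset.range j).image (fun i => q (2 * i)))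
      rw [h.unsat_inter Finset.subset_union_left, Finset.card_union_of_disjoint,
        h.card_cycleVerts, h4] at hle
      · omega
      · simp [Finset.disjoint_insert_right, hz, hz', hw, hw']
      · intro v hv hvσ
        simp only [Finset.mem_union, Finset.mem_insert, Finset.mem_singleton] at hv
        rcases hv with hv | rfl | rfl | rfl | rfl
        · exact hv
        · exact absurd hvσ hzσ
        · rw [h.max.invol] at hvσ; exact absurd hvσ.symm hzσ
        · exact absurd hvσ hwσ
        · rw [h.max.invol] at hvσ; exact absurd hvσ.symm hwσ
    · intro v hv
      simp only [Finset.mem_union, Finset.mem_insert, Finset.mem_singleton] at hv ⊢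
      rcases hv with hv | rfl | rfl | rfl | rfl
      · exact Or.inl (h.map_mem hv)
      all_goals simp [h.max.invol]
    · intro v hv
      simp only [Finset.mem_union, Finset.mem_insert, Finset.mem_singleton] at hv
      rw [Finset.mem_insert]
      rcases hv with hv | rfl | rfl | rfl | rfl
      · rcases h.dominates_even v hv with hh | ⟨x, hx, hvx⟩
        · exact Or.inl (Or.inr hh)
        · exact Or.inr ⟨x, Finset.mem_insert_of_mem hx, hvx⟩
      · exact Or.inr ⟨_, Finset.mem_insert_of_mem h0E, hcz.symm⟩
      · exact Or.inr ⟨w, Finset.mem_insert_self _ _, hzw⟩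
      · exact Or.inl (Or.inl rfl)
      · exact Or.inr ⟨w, Finset.mem_insert_self _ _, (h.max.adj w hwσ).symm⟩
    · intro u hu huW
      simp only [Finset.mem_union, Finset.mem_insert, Finset.mem_singleton, not_or] at huW
      obtain ⟨x, hux, hxz⟩ := hδ u z
      refine ⟨x, hux, ?_⟩
      by_cases hxw : x = w
      · exact Or.inl (hxw ▸ Finset.mem_insert_self _ _)
      right
      simp only [Finset.mem_union, Finset.mem_insert, Finset.mem_singleton, not_or]
      exact ⟨fun hx => h.not_adj hu huW.1 hx hux, hxz, fun hx => huz' u hu huW.1 (hx ▸ hux), hxw,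
        fun hx => huw' u hu huW.1 (hx ▸ hux)⟩

end IsFlower

/-- An edge joining two vertices missed by maximum matchings `σ` and `τ` closes the alternating
path of `σ` and `τ` between its ends to an odd cycle. -/
theorem IsMaxMatchingMap.exists_isFlower {σ τ : V → V} (hσ : G.IsMaxMatchingMap σ)
    (hτ : G.IsMaxMatchingMap τ) {u w : V} (hu : σ u = u) (hw : τ w = w) (huw : G.Adj u w) :
    ∃ j p, G.IsFlower σ j p := by
  obtain ⟨p, p0, p1⟩ : ∃ p : ℕ → V, p 0 = u ∧
      ∀ n, p (n + 1) = if n % 2 = 0 then τ (p n) else σ (p n) :=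
    ⟨fun n => Nat.rec u (fun n x => if n % 2 = 0 then τ x else σ x) n, rfl, fun _ => rfl⟩
  have pe : ∀ n, n % 2 = 0 → p (n + 1) = τ (p n) := fun n hn => by rw [p1, if_pos hn]
  have po : ∀ n, n % 2 = 1 → p (n + 1) = σ (p n) := fun n hn => by rw [p1, if_neg (by omega)]
  have pe' : ∀ n, n % 2 = 0 → τ (p (n + 1)) = p n := fun n hn => by rw [pe n hn, hτ.invol]
  have po' : ∀ n, n % 2 = 1 → σ (p (n + 1)) = p n := fun n hn => by rw [po n hn, hσ.invol]
  let Q : ℕ → Prop := fun m => ∀ i k, i ≤ m → k ≤ m → p i = p k → i = k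
  have hbound : ∃ m, ¬ Q m := by
    refine ⟨Fintype.card V, fun hQ => ?_⟩
    have := Finset.card_le_univ ((Finset.range (Fintype.card V + 1)).image p)
    rw [Finset.card_image_of_injOn, Finset.card_range] at this
    · omega
    · intro i hi k hk hik
      simp only [Finset.coe_range, Set.mem_Iio] at hi hk
      exact hQ i k (by omega) (by omega) hik
  obtain ⟨m, hm, hm1⟩ : ∃ m, Q m ∧ ¬ Q (m + 1) := by
    by_contra hcon
    push Not at hcon
    obtain ⟨m, hm⟩ := hbound
    refine hm ?_
    clear hm
    induction m with
    | zero => intro i k hi hk _; omega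
    | succ n ih => exact hcon n ih
  -- The path stops because its last vertex is missed by the matching to be followed next.
  have hend : p (m + 1) = p m := by
    have : ∃ i ≤ m, p (m + 1) = p i := by
      by_contra hcon
      push Not at hcon
      refine hm1 fun i k hi hk hik => ?_
      by_cases a : i = m + 1 <;> by_cases b : k = m + 1
      · omega
      · subst a; exact absurd hik (hcon k (by omega))
      · subst b; exact absurd hik.symm (hcon i (by omega))
      · exact hm i k (by omega) (by omega) hik
    obtain ⟨i, hi, hpi⟩ := this
    rcases Nat.lt_or_ge i m with him | him
    swap
    · rw [hpi, show i = m by omega]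
    exfalso
    rcases Nat.mod_two_eq_zero_or_one m with hm2 | hm2
    · rw [pe m hm2] at hpi
      have h1 : p m = τ (p i) := by rw [← hpi, hτ.invol]
      rcases Nat.mod_two_eq_zero_or_one i with hi2 | hi2
      · rw [← pe i hi2] at h1
        have := hm _ _ le_rfl (by omega) h1
        omega
      · obtain ⟨i, rfl⟩ : ∃ k, i = k + 1 := ⟨i - 1, by omega⟩
        rw [pe' i (by omega)] at h1
        have := hm _ _ le_rfl (by omega) h1
        omega
    · rw [po m hm2] at hpi
      have h1 : p m = σ (p i) := by rw [← hpi, hσ.invol]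
      rcases Nat.mod_two_eq_zero_or_one i with hi2 | hi2
      · rcases Nat.eq_zero_or_pos i with rfl | hi0
        · rw [p0, hu, ← p0] at h1
          have := hm _ _ le_rfl (by omega) h1
          omega
        · obtain ⟨i, rfl⟩ : ∃ k, i = k + 1 := ⟨i - 1, by omega⟩
          rw [po' i (by omega)] at h1
          have := hm _ _ le_rfl (by omega) h1
          omega
      · rw [← po i hi2] at h1
        have := hm _ _ le_rfl (by omega) h1
        omega
  let C : Finset V := (Finset.range (m + 1)).image p
  have hC : ∀ v, v ∈ C ↔ ∃ i ≤ m, p i = v := fun v => by simp [C]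
  have hCτ : ∀ v ∈ C, τ v ∈ C := by
    intro v hv
    obtain ⟨i, hi, rfl⟩ := (hC v).1 hv
    rw [hC]
    rcases Nat.mod_two_eq_zero_or_one i with hi2 | hi2
    · rw [← pe i hi2]
      rcases Nat.lt_or_ge i m with him | him
      · exact ⟨i + 1, him, rfl⟩
      · obtain rfl : i = m := by omega
        exact ⟨i, le_rfl, hend.symm⟩
    · obtain ⟨i, rfl⟩ : ∃ k, i = k + 1 := ⟨i - 1, by omega⟩
      exact ⟨i, by omega, (pe' i (by omega)).symm⟩
  have hCσ : ∀ v ∈ C, σ v ∈ C := by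
    intro v hv
    obtain ⟨i, hi, rfl⟩ := (hC v).1 hv
    rw [hC]
    rcases Nat.mod_two_eq_zero_or_one i with hi2 | hi2
    · rcases Nat.eq_zero_or_pos i with rfl | hi0
      · exact ⟨0, by omega, by rw [p0, hu]⟩
      · obtain ⟨i, rfl⟩ : ∃ k, i = k + 1 := ⟨i - 1, by omega⟩
        exact ⟨i, by omega, (po' i (by omega)).symm⟩
    · rw [← po i hi2]
      rcases Nat.lt_or_ge i m with him | him
      · exact ⟨i + 1, him, rfl⟩
      · obtain rfl : i = m := by omega
        exact ⟨i, le_rfl, hend.symm⟩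
  have huC : u ∈ C := (hC u).2 ⟨0, by omega, p0⟩
  have hwC : w ∈ C := by
    by_contra hwC
    refine (hσ.mix hτ C hCσ hCτ).not_adj (u := u) (v := w) ?_ ?_ huw
    · simp [huC, hu]
    · simp [hwC, hw]
  obtain ⟨i, hi, rfl⟩ := (hC w).1 hwC
  have hi2 : i % 2 = 0 := by
    by_contra hi2
    obtain ⟨i, rfl⟩ : ∃ k, i = k + 1 := ⟨i - 1, by omega⟩
    rw [pe' i (by omega)] at hw
    have := hm _ _ (by omega) (by omega) hw
    omega
  have him : i = m := by
    by_contra him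
    rw [← pe i hi2] at hw
    have := hm _ _ (by omega) (by omega) hw
    omega
  subst him
  obtain ⟨j, rfl⟩ : ∃ j, i = 2 * j := ⟨i / 2, by omega⟩
  refine ⟨j, p, hσ, hm, ?_, p0 ▸ huw.symm, by rw [p0, hu], ?_⟩
  · intro k hk
    have hne : p (k + 1) ≠ p k := fun hh => by
      have := hm _ _ (by omega) (by omega) hh
      omega
    rcases Nat.mod_two_eq_zero_or_one k with hk2 | hk2
    · rw [pe k hk2] at hne ⊢; exact hτ.adj _ hne
    · rw [po k hk2] at hne ⊢; exact hσ.adj _ hne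
  · intro k hk
    exact (po (2 * k + 1) (by omega)).symm

end

/-! ### Short odd cycles with chords of one length -/

/-- The cycle on `Fin n` together with the chords joining `x` to `x + d` for all `x` with `b x`. -/
def chordGraph (n : ℕ) [NeZero n] (d : Fin n) (b : Fin n → Bool) : SimpleGraph (Fin n) :=
  fromRel fun x y => y = x + 1 ∨ (y = x + d ∧ b x = true)

instance (n : ℕ) [NeZero n] (d : Fin n) (b : Fin n → Bool) : DecidableRel (chordGraph n d b).Adj :=
  fun x y => decidable_of_iff _ (fromRel_adj _ x y).symm

/-- Rotating the cycle rotates the set of chords. -/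
def chordGraphRotate (n : ℕ) [NeZero n] (d : Fin n) (b : Fin n → Bool) (r : Fin n) :
    chordGraph n d b ≃g chordGraph n d fun x => b (x + r) where
  toEquiv := (Equiv.addRight r).symm
  map_rel_iff' := by
    intro x y
    obtain ⟨x, rfl⟩ := (Equiv.addRight r).surjective x
    obtain ⟨y, rfl⟩ := (Equiv.addRight r).surjective y
    rw [Equiv.symm_apply_apply, Equiv.symm_apply_apply]
    simp [chordGraph, add_right_comm _ r]

/-- Up to rotation there are three sets of chords of `C_5` of which no two share an end. -/
theorem chordGraph_five (b : Fin 5 → Bool) (h : ∀ x, ¬ (b x = true ∧ b (x + 2) = true)) :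
    ∃ r, (fun x => b (x + r)) = (fun _ => false) ∨
      (fun x => b (x + r)) = (fun x => decide (x = 1)) ∨
      (fun x => b (x + r)) = (fun x => decide (x = 1 ∨ x = 2)) := by
  simp only [funext_iff]
  obtain ⟨b0, b1, b2, b3, b4, rfl⟩ : ∃ b0 b1 b2 b3 b4, b = ![b0, b1, b2, b3, b4] :=
    ⟨b 0, b 1, b 2, b 3, b 4, by ext i; fin_cases i <;> rfl⟩
  revert h
  revert b0 b1 b2 b3 b4
  decide

set_option maxRecDepth 10000 in
/-- The chords of length three of `C_7` form a 7-cycle in which the chords starting at `x` and at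
`x + 2` are as far apart as possible; a set without such a pair is contained in a path of three
chords. -/
theorem chordGraph_seven (b : Fin 7 → Bool) (h : ∀ x, ¬ (b x = true ∧ b (x + 2) = true)) :
    ∃ r, (fun x => b (x + r)) = (fun _ => false) ∨
      (fun x => b (x + r)) = (fun x => decide (x = 5)) ∨
      (fun x => b (x + r)) = (fun x => decide (x = 1 ∨ x = 2)) ∨
      (fun x => b (x + r)) = (fun x => decide (x = 1 ∨ x = 5)) ∨
      (fun x => b (x + r)) = (fun x => decide (x = 1 ∨ x = 2 ∨ x = 5)) := by
  simp only [funext_iff]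
  obtain ⟨b0, b1, b2, b3, b4, b5, b6, rfl⟩ :
      ∃ b0 b1 b2 b3 b4 b5 b6, b = ![b0, b1, b2, b3, b4, b5, b6] :=
    ⟨b 0, b 1, b 2, b 3, b 4, b 5, b 6, by ext i; fin_cases i <;> rfl⟩
  revert h
  revert b0 b1 b2 b3 b4 b5 b6
  decide

theorem cycleGraph_five_eq : cycleGraph 5 = chordGraph 5 2 (fun _ => false) := by
  ext x y; revert x y; decide

theorem cycleGraph_five_one_eq : cycleGraph 5 ⊔ fromEdgeSet {s(1, 3)} =
    chordGraph 5 2 (fun x => decide (x = 1)) := by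
  ext x y
  simp only [sup_adj, fromEdgeSet_adj, Set.mem_singleton_iff]
  revert x y; decide

theorem cycleGraph_five_two_eq : cycleGraph 5 ⊔ fromEdgeSet {s(1, 3), s(2, 4)} =
    chordGraph 5 2 (fun x => decide (x = 1 ∨ x = 2)) := by
  ext x y
  simp only [sup_adj, fromEdgeSet_adj, Set.mem_singleton_iff, Set.mem_insert_iff]
  revert x y; decide

theorem cycleGraph_seven_eq : cycleGraph 7 = chordGraph 7 3 (fun _ => false) := by
  ext x y; revert x y; decide

theorem cycleGraph_seven_one_eq : cycleGraph 7 ⊔ fromEdgeSet {s(1, 5)} =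
    chordGraph 7 3 (fun x => decide (x = 5)) := by
  ext x y
  simp only [sup_adj, fromEdgeSet_adj, Set.mem_singleton_iff]
  revert x y; decide

theorem cycleGraph_seven_crossing_eq : cycleGraph 7 ⊔ fromEdgeSet {s(1, 4), s(2, 5)} =
    chordGraph 7 3 (fun x => decide (x = 1 ∨ x = 2)) := by
  ext x y
  simp only [sup_adj, fromEdgeSet_adj, Set.mem_singleton_iff, Set.mem_insert_iff]
  revert x y; decide

theorem cycleGraph_seven_adjacent_eq : cycleGraph 7 ⊔ fromEdgeSet {s(1, 4), s(1, 5)} =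
    chordGraph 7 3 (fun x => decide (x = 1 ∨ x = 5)) := by
  ext x y
  simp only [sup_adj, fromEdgeSet_adj, Set.mem_singleton_iff, Set.mem_insert_iff]
  revert x y; decide

theorem cycleGraph_seven_three_eq : cycleGraph 7 ⊔ fromEdgeSet {s(1, 4), s(1, 5), s(2, 5)} =
    chordGraph 7 3 (fun x => decide (x = 1 ∨ x = 2 ∨ x = 5)) := by
  ext x y
  simp only [sup_adj, fromEdgeSet_adj, Set.mem_singleton_iff, Set.mem_insert_iff]
  revert x y; decide

theorem isExceptional_iff {V : Type*} (G : SimpleGraph V) : G.IsExceptional ↔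
    Nonempty (G ≃g cycleGraph 3) ∨
    Nonempty (G ≃g chordGraph 5 2 fun _ => false) ∨
    Nonempty (G ≃g chordGraph 5 2 fun x => decide (x = 1)) ∨
    Nonempty (G ≃g chordGraph 5 2 fun x => decide (x = 1 ∨ x = 2)) ∨
    Nonempty (G ≃g chordGraph 7 3 fun _ => false) ∨
    Nonempty (G ≃g chordGraph 7 3 fun x => decide (x = 5)) ∨
    Nonempty (G ≃g chordGraph 7 3 fun x => decide (x = 1 ∨ x = 2)) ∨
    Nonempty (G ≃g chordGraph 7 3 fun x => decide (x = 1 ∨ x = 5)) ∨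
    Nonempty (G ≃g chordGraph 7 3 fun x => decide (x = 1 ∨ x = 2 ∨ x = 5)) := by
  rw [IsExceptional, cycleGraph_five_one_eq, cycleGraph_five_two_eq, cycleGraph_seven_one_eq,
    cycleGraph_seven_crossing_eq, cycleGraph_seven_adjacent_eq, cycleGraph_seven_three_eq,
    cycleGraph_five_eq, cycleGraph_seven_eq]

theorem isExceptional_of_chordGraph_five {V : Type*} {G : SimpleGraph V} {b : Fin 5 → Bool}
    (e : G ≃g chordGraph 5 2 b) (h : ∀ x, ¬ (b x = true ∧ b (x + 2) = true)) :
    G.IsExceptional := by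
  rw [isExceptional_iff]
  obtain ⟨r, hr⟩ := chordGraph_five b h
  have e' := e.trans (chordGraphRotate 5 2 b r)
  rcases hr with hr | hr | hr <;> rw [hr] at e'
  · exact Or.inr (Or.inl ⟨e'⟩)
  · exact Or.inr (Or.inr (Or.inl ⟨e'⟩))
  · exact Or.inr (Or.inr (Or.inr (Or.inl ⟨e'⟩)))

theorem isExceptional_of_chordGraph_seven {V : Type*} {G : SimpleGraph V} {b : Fin 7 → Bool}
    (e : G ≃g chordGraph 7 3 b) (h : ∀ x, ¬ (b x = true ∧ b (x + 2) = true)) :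
    G.IsExceptional := by
  rw [isExceptional_iff]
  obtain ⟨r, hr⟩ := chordGraph_seven b h
  have e' := e.trans (chordGraphRotate 7 3 b r)
  rcases hr with hr | hr | hr | hr | hr <;> rw [hr] at e'
  · exact Or.inr (Or.inr (Or.inr (Or.inr (Or.inl ⟨e'⟩))))
  · exact Or.inr (Or.inr (Or.inr (Or.inr (Or.inr (Or.inl ⟨e'⟩)))))
  · exact Or.inr (Or.inr (Or.inr (Or.inr (Or.inr (Or.inr (Or.inl ⟨e'⟩))))))
  · exact Or.inr (Or.inr (Or.inr (Or.inr (Or.inr (Or.inr (Or.inr (Or.inl ⟨e'⟩)))))))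
  · exact Or.inr (Or.inr (Or.inr (Or.inr (Or.inr (Or.inr (Or.inr (Or.inr ⟨e'⟩)))))))

theorem IsDominatingSet.map {V W : Type*} {G : SimpleGraph V} {H : SimpleGraph W} (e : G ≃g H)
    {D : Finset V} (h : G.IsDominatingSet D) : H.IsDominatingSet (D.map e.toEquiv.toEmbedding) := by
  intro w
  obtain ⟨v, rfl⟩ := e.surjective w
  rcases h v with hv | ⟨u, hu, hvu⟩
  · exact Or.inl (Finset.mem_map_of_mem _ hv)
  · exact Or.inr ⟨e u, Finset.mem_map_of_mem _ hu, e.map_adj_iff.2 hvu⟩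

/-- A graph on `Fin 5` containing the cycle and without a dominating vertex has no two chords at
the same vertex. -/
theorem exists_chordGraph_five (H : SimpleGraph (Fin 5)) (hc : ∀ x, H.Adj x (x + 1))
    (hd : ∀ D, H.IsDominatingSet D → 2 ≤ D.card) :
    ∃ b : Fin 5 → Bool, H = chordGraph 5 2 b ∧ ∀ x, ¬ (b x = true ∧ b (x + 2) = true) := by
  classical
  refine ⟨fun x => decide (H.Adj x (x + 2)), ?_, ?_⟩
  · ext x y
    have h : ∀ x y : Fin 5, x = y ∨ y = x + 1 ∨ x = y + 1 ∨ y = x + 2 ∨ x = y + 2 := by decide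
    have h1 : ∀ x : Fin 5, x ≠ x + 1 := by decide
    have h2 : ∀ x : Fin 5, x ≠ x + 2 := by decide
    have h3 : ∀ x y : Fin 5, y = x + 2 → ¬ (y = x + 1 ∨ x = y + 1 ∨ x = y + 2) := by decide
    simp only [chordGraph, fromRel_adj, decide_eq_true_eq]
    rcases h x y with rfl | rfl | rfl | rfl | rfl
    · simp
    · simp [hc, h1]
    · simp [(hc y).symm, (h1 y).symm]
    · have := h3 x _ rfl
      simp only [not_or] at this
      simp [this, h2]
    · have := h3 y _ rfl
      simp only [not_or] at this
      simp [this, (h2 y).symm, H.adj_comm]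
  · intro x
    simp only [decide_eq_true_eq]
    rintro ⟨h1, h2⟩
    have := hd {x + 2} ?_
    · simp at this
    intro y
    have h : ∀ x y : Fin 5, y = x ∨ y = x + 1 ∨ y = x + 2 ∨ y = x + 3 ∨ y = x + 4 := by decide
    simp only [Finset.mem_singleton, exists_eq_left]
    have e1 : x + 1 + 1 = x + 2 := by rw [add_assoc]; rfl
    have e2 : x + 2 + 1 = x + 3 := by rw [add_assoc]; rfl
    have e3 : x + 2 + 2 = x + 4 := by rw [add_assoc]; rfl
    rcases h x y with rfl | rfl | rfl | rfl | rfl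
    · exact Or.inr h1
    · exact Or.inr (e1 ▸ hc _)
    · exact Or.inl rfl
    · exact Or.inr (e2 ▸ hc _).symm
    · exact Or.inr (e3 ▸ h2).symm

/-- A graph on `Fin 7` containing the cycle and without a dominating pair has only chords of length
three, since a chord `x, x + 2` makes `{x, x + 4}` dominating. The chords starting at `x` and at
`x + 2` do not both occur, since with them `{x, x + 5}` is dominating. -/
theorem exists_chordGraph_seven (H : SimpleGraph (Fin 7)) (hc : ∀ x, H.Adj x (x + 1))
    (hd : ∀ D, H.IsDominatingSet D → 3 ≤ D.card) :
    ∃ b : Fin 7 → Bool, H = chordGraph 7 3 b ∧ ∀ x, ¬ (b x = true ∧ b (x + 2) = true) := by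
  classical
  have hall : ∀ x y : Fin 7, y = x ∨ y = x + 1 ∨ y = x + 2 ∨ y = x + 3 ∨ y = x + 4 ∨ y = x + 5 ∨
    y = x + 6 := by decide
  have e4 : ∀ x : Fin 7, x + 3 + 1 = x + 4 := by decide
  have e5 : ∀ x : Fin 7, x + 4 + 1 = x + 5 := by decide
  have e7 : ∀ x : Fin 7, x + 6 + 1 = x := by decide
  have c3 := fun x => e4 x ▸ hc (x + 3)
  have c4 := fun x => e5 x ▸ hc (x + 4)
  have c6 := fun x => e7 x ▸ hc (x + 6)
  -- No pair of vertices is dominating.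
  have hpair : ∀ x y, ∃ z, z ≠ x ∧ z ≠ y ∧ ¬ H.Adj z x ∧ ¬ H.Adj z y := by
    intro x y
    by_contra hcon
    push Not at hcon
    have := (hd {x, y} ?_).trans Finset.card_le_two
    · omega
    intro z
    have := hcon z
    simp only [Finset.mem_insert, Finset.mem_singleton, exists_eq_or_imp, exists_eq_left]
    tauto
  have hshort : ∀ x, ¬ H.Adj x (x + 2) := by
    intro x h
    obtain ⟨z, h1, h2, h3, h4⟩ := hpair x (x + 4)
    rcases hall x z with rfl | rfl | rfl | rfl | rfl | rfl | rfl
    · exact h1 rfl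
    · exact h3 (hc x).symm
    · exact h3 h.symm
    · exact h4 (c3 x)
    · exact h2 rfl
    · exact h4 (c4 x).symm
    · exact h3 (c6 x)
  refine ⟨fun x => decide (H.Adj x (x + 3)), ?_, ?_⟩
  · ext x y
    have h : ∀ x y : Fin 7, x = y ∨ y = x + 1 ∨ x = y + 1 ∨ y = x + 2 ∨ x = y + 2 ∨ y = x + 3 ∨
      x = y + 3 := by decide
    have h1 : ∀ x : Fin 7, x ≠ x + 1 := by decide
    have h2 : ∀ x y : Fin 7, y = x + 2 → ¬ (y = x + 1 ∨ x = y + 1 ∨ y = x + 3 ∨ x = y + 3) := by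
      decide
    have h3 : ∀ x y : Fin 7, y = x + 3 → ¬ (x = y ∨ y = x + 1 ∨ x = y + 1 ∨ x = y + 3) := by decide
    simp only [chordGraph, fromRel_adj, decide_eq_true_eq]
    rcases h x y with rfl | rfl | rfl | rfl | rfl | rfl | rfl
    · simp
    · simp [hc, h1]
    · simp [(hc y).symm, (h1 y).symm]
    · have := h2 x _ rfl
      simp only [not_or] at this
      simp [this, hshort]
    · have := h2 y _ rfl
      have h' : ¬ H.Adj (y + 2) y := fun hh => hshort y hh.symm
      simp only [not_or] at this
      simp [this, h']
    · have := h3 x _ rfl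
      simp only [not_or] at this
      simp [this]
    · have := h3 y _ rfl
      simp only [not_or] at this
      have h5 : y + 3 ≠ y := fun h => this.1 h.symm
      simp [this, h5, H.adj_comm]
  · intro x
    simp only [decide_eq_true_eq]
    rintro ⟨h, h'⟩
    rw [show x + 2 + 3 = x + 5 by rw [add_assoc]; rfl] at h'
    obtain ⟨z, h1, h2, h3, h4⟩ := hpair x (x + 5)
    rcases hall x z with rfl | rfl | rfl | rfl | rfl | rfl | rfl
    · exact h1 rfl
    · exact h3 (hc x).symm
    · exact h4 h'
    · exact h3 h.symm
    · exact h4 (c4 x)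
    · exact h2 rfl
    · exact h3 (c6 x)

/-- A dominating set of an exceptional graph on `2 * k + 1` vertices has at least `k` elements. -/
theorem IsExceptional.card_le {V : Type*} [Fintype V] {G : SimpleGraph V} (h : G.IsExceptional)
    {D : Finset V} (hD : G.IsDominatingSet D) : Fintype.card V ≤ 2 * D.card + 1 := by
  classical
  rw [isExceptional_iff] at h
  have key5 : ∀ b, (G ≃g chordGraph 5 2 b) →
      (∀ x, ∃ z, z ≠ x ∧ ¬ (chordGraph 5 2 b).Adj z x) → Fintype.card V ≤ 2 * D.card + 1 := by
    intro b e hb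
    rw [Fintype.card_congr e.toEquiv, Fintype.card_fin]
    by_contra hcon
    have h1 : (D.map e.toEquiv.toEmbedding).card ≤ 1 := by rw [Finset.card_map]; omega
    obtain ⟨x, hx⟩ := Finset.card_le_one_iff_subset_singleton.1 h1
    obtain ⟨z, hz1, hz2⟩ := hb x
    rcases hD.map e z with h | ⟨u, hu, huz⟩
    · exact hz1 (Finset.mem_singleton.1 (hx h))
    · exact hz2 (Finset.mem_singleton.1 (hx hu) ▸ huz)
  have key7 : ∀ b, (G ≃g chordGraph 7 3 b) →
      (∀ x y, ∃ z, z ≠ x ∧ z ≠ y ∧ ¬ (chordGraph 7 3 b).Adj z x ∧ ¬ (chordGraph 7 3 b).Adj z y) →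
      Fintype.card V ≤ 2 * D.card + 1 := by
    intro b e hb
    rw [Fintype.card_congr e.toEquiv, Fintype.card_fin]
    by_contra hcon
    have h1 : (D.map e.toEquiv.toEmbedding).card ≤ 2 := by rw [Finset.card_map]; omega
    obtain ⟨x, y, hxy⟩ : ∃ x y, D.map e.toEquiv.toEmbedding ⊆ {x, y} := by
      obtain ⟨E, hE, -, hE2⟩ := Finset.exists_subsuperset_card_eq
        (Finset.subset_univ (D.map e.toEquiv.toEmbedding)) h1 (by simp)
      obtain ⟨x, y, -, rfl⟩ := Finset.card_eq_two.1 hE2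
      exact ⟨x, y, hE⟩
    obtain ⟨z, hz1, hz2, hz3, hz4⟩ := hb x y
    have hmem : ∀ v ∈ D.map e.toEquiv.toEmbedding, v = x ∨ v = y := fun v hv => by
      simpa using hxy hv
    rcases hD.map e z with h | ⟨u, hu, huz⟩
    · exact (hmem z h).elim hz1 hz2
    · rcases hmem u hu with rfl | rfl
      exacts [hz3 huz, hz4 huz]
  rcases h with ⟨⟨e⟩⟩ | ⟨⟨e⟩⟩ | ⟨⟨e⟩⟩ | ⟨⟨e⟩⟩ | ⟨⟨e⟩⟩ | ⟨⟨e⟩⟩ | ⟨⟨e⟩⟩ | ⟨⟨e⟩⟩ | ⟨⟨e⟩⟩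
  · rw [Fintype.card_congr e.toEquiv, Fintype.card_fin]
    have : 0 < D.card := by
      rw [Finset.card_pos]
      rcases hD (e.symm 0) with h | ⟨u, hu, -⟩
      exacts [⟨_, h⟩, ⟨_, hu⟩]
    omega
  · exact key5 _ e (by decide)
  · exact key5 _ e (by decide)
  · exact key5 _ e (by decide)
  · exact key7 _ e (by decide)
  · exact key7 _ e (by decide)
  · exact key7 _ e (by decide)
  · exact key7 _ e (by decide)
  · exact key7 _ e (by decide)

/-! ### The characterisation -/

section

variable {V : Type*} [Fintype V] [DecidableEq V] {G : SimpleGraph V}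

namespace IsFlower

variable {σ : V → V} {j : ℕ} {q : ℕ → V}

theorem le_card_of_spanning (hT : G.IsTight) (h : G.IsFlower σ j q)
    (hs : ∀ v, v ∈ cycleVerts j q) {D : Finset V} (hD : G.IsDominatingSet D) : j ≤ D.card := by
  have h1 := hT σ h.max D hD
  have h2 := h.unsat_inter (W := Finset.univ) (Finset.subset_univ _) (fun v _ _ => hs v)
  have h3 := h.card_cycleVerts
  rw [Finset.eq_univ_iff_forall.2 hs, Finset.card_univ] at h3
  rw [Finset.inter_univ] at h2
  omega

/-- Every third vertex of a spanning cycle forms a dominating set. -/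
theorem le_three (hT : G.IsTight) (h : G.IsFlower σ j q) (hs : ∀ v, v ∈ cycleVerts j q) :
    j ≤ 3 := by
  have hD : G.IsDominatingSet ((Finset.range (2 * j / 3 + 1)).image fun i => q (3 * i)) := by
    intro v
    obtain ⟨k, hk, rfl⟩ := mem_cycleVerts.1 (hs v)
    simp only [Finset.mem_image, Finset.mem_range, exists_exists_and_eq_and]
    obtain ⟨i, rfl | rfl | rfl⟩ : ∃ i, k = 3 * i ∨ k = 3 * i + 1 ∨ k = 3 * i + 2 :=
      ⟨k / 3, by omega⟩
    · exact Or.inl ⟨i, by omega, rfl⟩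
    · exact Or.inr ⟨i, by omega, (h.adj (3 * i) (by omega)).symm⟩
    · right
      by_cases hi : 3 * i + 2 = 2 * j
      · exact ⟨0, by omega, hi ▸ h.adj_last⟩
      · exact ⟨i + 1, by omega, h.adj (3 * i + 2) (by omega)⟩
  have h1 := (h.le_card_of_spanning hT hs hD).trans Finset.card_image_le
  rw [Finset.card_range] at h1
  omega

theorem isExceptional (hT : G.IsTight) (h : G.IsFlower σ j q) (hs : ∀ v, v ∈ cycleVerts j q) :
    G.IsExceptional := by
  let e : Fin (2 * j + 1) ≃ V := Equiv.ofBijective (fun i => q i) ⟨fun i k hik =>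
    Fin.ext (h.inj i k (by omega) (by omega) hik), fun v => by
      obtain ⟨k, hk, rfl⟩ := mem_cycleVerts.1 (hs v)
      exact ⟨⟨k, by omega⟩, rfl⟩⟩
  let f : G.comap e ≃g G := Iso.comap e G
  have hd : ∀ D, (G.comap e).IsDominatingSet D → j ≤ D.card := fun D hD => by
    simpa using h.le_card_of_spanning hT hs (hD.map f)
  have hc : ∀ x : Fin (2 * j + 1), (G.comap e).Adj x (x + 1) := by
    intro x
    change G.Adj (q x.val) (q (x + 1).val)
    rw [Fin.val_add_one]
    split_ifs with hx
    · subst hx; exact h.adj_last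
    · refine h.adj _ ?_
      have : x.val ≠ 2 * j := fun hh => hx (Fin.ext hh)
      omega
  have h3 := h.le_three hT hs
  have h1 := h.one_le
  clear_value f
  generalize G.comap e = H at *
  clear e
  obtain rfl | rfl | rfl : j = 1 ∨ j = 2 ∨ j = 3 := by omega
  · left
    have hH : H = cycleGraph 3 := by
      rw [cycleGraph_three_eq_top]
      ext x y
      rw [top_adj]
      refine ⟨fun hxy => hxy.ne, fun hxy => ?_⟩
      have : ∀ x y : Fin 3, x ≠ y → y = x + 1 ∨ x = y + 1 := by decide
      rcases this x y hxy with rfl | rfl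
      exacts [hc x, (hc y).symm]
    exact ⟨hH ▸ f.symm⟩
  · obtain ⟨b, hH, hb⟩ := exists_chordGraph_five H hc hd
    exact isExceptional_of_chordGraph_five (hH ▸ f.symm) hb
  · obtain ⟨b, hH, hb⟩ := exists_chordGraph_seven H hc hd
    exact isExceptional_of_chordGraph_seven (hH ▸ f.symm) hb

end IsFlower

/-- The structure of tight graphs: either two vertices missed by maximum matchings are adjacent,
and a longest flower is the whole graph, or there are none such and the graph is bipartite. -/
theorem IsTight.classification (hT : G.IsTight) (hc : G.Connected)
    (hδ : ∀ v a, ∃ w, G.Adj v w ∧ w ≠ a) :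
    G.IsExceptional ∨ ∃ X Y : Finset V, G.IsBipartiteWith (X : Set V) (Y : Set V) ∧
      (X : Set V) ∪ (Y : Set V) = Set.univ ∧
      G.girth = 4 ∧ G.dominationNumber = X.card ∧ X.card ≤ Y.card := by
  by_cases hF : ∃ j σ q, G.IsFlower σ j q
  · left
    have hbound : ∀ j, (∃ σ q, G.IsFlower σ j q) → j ≤ Fintype.card V := by
      rintro j ⟨σ, q, h⟩
      have := (Finset.card_le_univ _).trans' h.card_cycleVerts.ge
      omega
    classical
    have hne : (Finset.range (Fintype.card V + 1)).filter
        (fun j => ∃ σ q, G.IsFlower σ j q) |>.Nonempty := by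
      obtain ⟨j, h⟩ := hF
      exact ⟨j, by simpa [Nat.lt_succ_iff] using ⟨hbound j h, h⟩⟩
    obtain ⟨j, hj, hmax⟩ := Finset.exists_max_image _ id hne
    simp only [Finset.mem_filter, Finset.mem_range, id] at hj hmax
    obtain ⟨-, σ, q, h⟩ := hj
    refine h.isExceptional hT (h.spanning hT hc hδ fun τ i q' h' => ?_)
    exact hmax i ⟨Nat.lt_succ_of_le (hbound i ⟨τ, q', h'⟩), τ, q', h'⟩
  · right
    obtain ⟨σ, hσ⟩ := exists_isMaxMatchingMap G
    rcases (unsat σ).eq_empty_or_nonempty with h | h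
    · refine hT.bipartite_of_perfect hc hδ hσ fun v hv => ?_
      have := mem_unsat.2 hv
      simp [h] at this
    · refine hT.bipartite_of_unsat_nonempty hc hδ ?_ hσ h
      intro τ ρ u w hτ hρ hu hw huw
      obtain ⟨j, q, hq⟩ := hτ.exists_isFlower hρ hu hw huw
      exact hF ⟨j, τ, q, hq⟩

end

end SimpleGraph

theorem theorem2p3 {V : Type*} [Fintype V] (G : SimpleGraph V) [DecidableRel G.Adj]
    (hconn : G.Connected) (hdeg : 2 ≤ G.minDegree) :
    G.IsStarUniform ↔
      G.IsExceptional ∨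
        ∃ X Y : Finset V, G.IsBipartiteWith (X : Set V) (Y : Set V) ∧
          (X : Set V) ∪ (Y : Set V) = Set.univ ∧
          G.girth = 4 ∧ G.dominationNumber = X.card ∧ X.card ≤ Y.card := by
  classical
  constructor
  · intro hU
    have hδ : ∀ v a, ∃ w, G.Adj v w ∧ w ≠ a := by
      intro v a
      have h : 1 < (G.neighborFinset v).card := hdeg.trans (G.minDegree_le_degree v)
      obtain ⟨w, hw, hwa⟩ := Finset.exists_mem_ne h a
      exact ⟨w, (G.mem_neighborFinset v w).1 hw, hwa⟩
    exact (hU.isTight fun v => ⟨_, (hδ v v).choose_spec.1⟩).classification hconn hδ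
  · rintro (hE | ⟨X, Y, hXY, -, -, hγ, -⟩)
    · -- The order is at most one more than twice any dominating set, and at least twice the number
      -- of components.
      have key : ∀ S, G.IsStarFactor S → Fintype.card V ≤ 2 * Nat.card S.ConnectedComponent + 1 ∧
          2 * Nat.card S.ConnectedComponent ≤ Fintype.card V := by
        intro S hS
        obtain ⟨D, hD, hDc⟩ := hS.exists_isDominatingSet
        exact ⟨hDc ▸ hE.card_le hD, hS.two_mul_card_le⟩
      intro S T hS hT
      have h1 := key S hS
      have h2 := key T hT
      omega
    · -- The number of components lies between the domination number and the size of the cover `X`.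
      have key : ∀ S, G.IsStarFactor S → Nat.card S.ConnectedComponent = X.card := by
        intro S hS
        obtain ⟨D, hD, hDc⟩ := hS.exists_isDominatingSet
        refine le_antisymm (hS.card_le_of_cover X fun v w hvw => ?_) ?_
        · rcases hXY.mem_of_adj hvw with h | h
          · exact Or.inl (by simpa using h.1)
          · exact Or.inr (by simpa using h.2)
        · rw [← hγ, ← hDc]
          exact SimpleGraph.dominationNumber_le hD
      intro S T hS hT
      rw [key S hS, key T hT]
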